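/- Let $(R,\mathfrak m)$ be a Noetherian local ring of dimension $d>0$ and let $I$ be an $\mathfrak m$-primary ideal of $R$. For an ideal $J$ let $\overline{J}$ denote its integral closure, let $\ell$ denote length, and let $\ell\ell(I)$ be the Loewy length of $R/I$, i.e. the smallest integer $n$ with $\mathfrak m^n\subseteq I$. Define the fiber cone and the normal fiber cone of $I$ as the graded rings $$F(I)=\bigoplus_{n\ge 0} I^n/\mathfrak m I^n,\qquad \overline{F}(I)=\bigoplus_{n\ge 0}\overline{I^n}/\mathfrak m\,\overline{I^n},$$ that is, the closed fibers of $\bigoplus_n I^n t^n$ and of $\bigoplus_n \overline{I^n}t^n\subseteq R[t]$. Put $$\operatorname{e}(I)=\lim_{n\to\infty}\frac{d!\,\ell(R/I^n)}{n^d},\qquad \overline{\operatorname{e}}(I)=\lim_{n\to\infty}\frac{d!\,\ell(R/\overline{I^n})}{n^d},$$ and, for $A=\bigoplus_n A_n$ equal to $F(I)$ or $\overline{F}(I)$, of Krull dimension $\delta$, put $$\operatorname{e}(A)=\lim_{n\to\infty}\frac{(\delta-1)!\,\ell(A_n)}{n^{\delta-1}}.$$ (All these limits are read as upper limits in $[0,\infty]$,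 so that no convergence has to be presupposed; whenever a limit exists it is the value.) Then $$\overline{\operatorname{e}}(I)\le \operatorname{e}(\overline{F}(I))\cdot \ell\ell(I).$$ Consequently, if $I$ is normal, i.e. $\overline{I^n}=I^n$ for all $n$, then $$\operatorname{e}(I)\le \operatorname{e}(F(I))\cdot\ell\ell(I).$$ -/

import Mathlib

open Polynomial Filter IsLocalRing
open scoped ENNReal

/-! ### Integral closure of an ideal and the normal Rees algebra -/

namespace Ideal

variable {R : Type*} [CommRing R]

/-- `x` is integral over the ideal `I`: it is a root of a monic polynomial
`X ^ r + a₁ X ^ (r - 1) + ⋯ + aᵣ` with `aⱼ ∈ I ^ j` for all `j`. -/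
def IsIntegralElem (I : Ideal R) (x : R) : Prop :=
  ∃ p : R[X], p.Monic ∧ (∀ i, p.coeff i ∈ I ^ (p.natDegree - i)) ∧ p.eval x = 0

/-- An element `x` is integral over `I ^ n` if and only if `x t ^ n` is integral over the Rees
algebra `R[I t] ⊆ R[t]`. -/
theorem isIntegralElem_pow_iff (I : Ideal R) (n : ℕ) (x : R) :
    (I ^ n).IsIntegralElem x ↔ IsIntegral (reesAlgebra I) (monomial n x : R[X]) := by
  constructor
  · rintro ⟨p, hp, hc, hx⟩
    rcases subsingleton_or_nontrivial R with hR | hR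
    · exact (Subsingleton.elim (0 : R[X]) (monomial n x)) ▸ isIntegral_zero
    have hmem : ∀ i, monomial (n * (p.natDegree - i)) (p.coeff i) ∈ reesAlgebra I := fun i => by
      rw [reesAlgebra.monomial_mem, pow_mul]; exact hc i
    let q : (reesAlgebra I)[X] :=
      ∑ i ∈ Finset.range (p.natDegree + 1), monomial i (⟨_, hmem i⟩ : reesAlgebra I)
    have hqc : ∀ j, q.coeff j = if j < p.natDegree + 1 then ⟨_, hmem j⟩ else 0 := fun j => by
      simp [q, coeff_monomial]
    refine ⟨q, ?_, ?_⟩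
    · refine monic_of_natDegree_le_of_coeff_eq_one p.natDegree ?_ ?_
      · refine natDegree_le_iff_coeff_eq_zero.mpr fun j hj => ?_
        rw [hqc, if_neg (by omega)]
      · rw [hqc, if_pos (by omega)]
        ext1
        simp [hp.coeff_natDegree]
    · have h1 : ∀ i ∈ Finset.range (p.natDegree + 1),
          (monomial (n * (p.natDegree - i)) (p.coeff i) : R[X]) * (monomial n x) ^ i
            = monomial (n * p.natDegree) (p.coeff i * x ^ i) := fun i hi => by
        rw [monomial_pow, monomial_mul_monomial, ← mul_add,
          Nat.sub_add_cancel (by have := Finset.mem_range.mp hi; omega)]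
      simp only [q, eval₂_finsetSum, eval₂_monomial]
      refine (Finset.sum_congr rfl h1).trans ?_
      rw [← map_sum, ← eval_eq_sum_range, hx, map_zero]
  · rintro ⟨q, hq, hx⟩
    rcases subsingleton_or_nontrivial R with hR | hR
    · exact ⟨1, monic_one, fun i => by
        rw [Subsingleton.elim (coeff 1 i) 0]; exact zero_mem _, Subsingleton.elim _ _⟩
    let c : ℕ → R := fun i => (q.coeff i : R[X]).coeff (n * (q.natDegree - i))
    let p : R[X] := ∑ i ∈ Finset.range (q.natDegree + 1), monomial i (c i)
    have hpc : ∀ j, p.coeff j = if j < q.natDegree + 1 then c j else 0 := fun j => by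
      simp [p, coeff_monomial]
    have htop : p.coeff q.natDegree = 1 := by
      rw [hpc, if_pos (by omega)]
      simp [c, hq.coeff_natDegree]
    have hle : p.natDegree ≤ q.natDegree := by
      refine natDegree_le_iff_coeff_eq_zero.mpr fun j hj => ?_
      rw [hpc, if_neg (by omega)]
    have hdeg : p.natDegree = q.natDegree :=
      le_antisymm hle (le_natDegree_of_ne_zero (by rw [htop]; exact one_ne_zero))
    refine ⟨p, monic_of_natDegree_le_of_coeff_eq_one _ hle htop, fun i => ?_, ?_⟩
    · rw [hdeg, hpc]
      split_ifs with h
      · rw [← pow_mul]; exact (q.coeff i).2 _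
      · exact zero_mem _
    · have h2 := congrArg (fun f : R[X] => f.coeff (n * q.natDegree)) hx
      simp only [eval₂_eq_sum_range, finsetSum_coeff, coeff_zero] at h2
      rw [← h2, eval_finsetSum]
      refine Finset.sum_congr rfl fun i hi => ?_
      have hi' : n * q.natDegree = n * (q.natDegree - i) + n * i := by
        rw [← mul_add, Nat.sub_add_cancel (by have := Finset.mem_range.mp hi; omega)]
      rw [eval_monomial, monomial_pow, hi', coeff_mul_monomial]
      rfl

/-- The integral closure of the ideal `I` in `R`. -/
def intClosure (I : Ideal R) : Ideal R where
  carrier := {x | I.IsIntegralElem x}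
  zero_mem' := by
    have := isIntegralElem_pow_iff I 1 0
    rw [pow_one] at this
    rw [Set.mem_ofPred_eq, this, map_zero]
    exact isIntegral_zero
  add_mem' {x y} hx hy := by
    have := isIntegralElem_pow_iff I 1
    simp only [pow_one] at this
    rw [Set.mem_ofPred_eq, this] at hx hy ⊢
    rw [map_add]
    exact hx.add hy
  smul_mem' r x hx := by
    have := isIntegralElem_pow_iff I 1
    simp only [pow_one] at this
    rw [Set.mem_ofPred_eq, this] at hx ⊢
    rw [smul_eq_mul, ← C_mul_monomial]
    exact (isIntegral_algebraMap (x := algebraMap R (reesAlgebra I) r)).mul hx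

theorem mem_intClosure_pow_iff (I : Ideal R) (n : ℕ) (x : R) :
    x ∈ (I ^ n).intClosure ↔ IsIntegral (reesAlgebra I) (monomial n x : R[X]) :=
  isIntegralElem_pow_iff I n x

/-- An ideal is normal if all of its powers are integrally closed. -/
def IsNormal (I : Ideal R) : Prop :=
  ∀ n : ℕ, (I ^ n).intClosure = I ^ n

/-- The normal Rees algebra `⨁ₙ (integral closure of I ^ n) t ^ n`, as a subalgebra of `R[t]`. -/
def normalReesAlgebra (I : Ideal R) : Subalgebra R R[X] where
  carrier := {f | ∀ n, f.coeff n ∈ (I ^ n).intClosure}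
  mul_mem' {f g} hf hg n := by
    rw [coeff_mul]
    refine Ideal.sum_mem _ fun ij hij => ?_
    rw [mem_intClosure_pow_iff, ← Finset.HasAntidiagonal.mem_antidiagonal.mp hij, ← monomial_mul_monomial]
    exact ((mem_intClosure_pow_iff I _ _).mp (hf _)).mul ((mem_intClosure_pow_iff I _ _).mp (hg _))
  add_mem' {f g} hf hg n := by
    rw [coeff_add]
    exact Ideal.add_mem _ (hf n) (hg n)
  algebraMap_mem' r n := by
    rw [algebraMap_eq, coeff_C]
    split_ifs with h
    · subst h
      rw [mem_intClosure_pow_iff, monomial_zero_left]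
      exact isIntegral_algebraMap (x := algebraMap R (reesAlgebra I) r)
    · exact zero_mem _

end Ideal

/-! ### Fiber cones -/

section FiberCone

variable {R : Type*} [CommRing R] [IsLocalRing R]

/-- The closed fiber `S / 𝔪 S` of a subalgebra `S` of `R[t]`. -/
abbrev ClosedFiber (S : Subalgebra R R[X]) : Type _ :=
  S ⧸ (maximalIdeal R).map (algebraMap R S)

/-- The degree `n` part of the closed fiber `S / 𝔪 S`: the classes of the elements of `S` of the
form `x t ^ n`. -/
noncomputable def ClosedFiber.degreePart (S : Subalgebra R R[X]) (n : ℕ) : Submodule R (ClosedFiber S) :=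
  ((LinearMap.range (monomial n : R →ₗ[R] R[X])).comap S.val.toLinearMap).map
    (Ideal.Quotient.mkₐ R ((maximalIdeal R).map (algebraMap R S))).toLinearMap

/-- The fiber cone `F(I) = ⨁ₙ I ^ n / 𝔪 I ^ n`, the closed fiber of the Rees algebra of `I`. -/
abbrev FiberCone (I : Ideal R) : Type _ := ClosedFiber (reesAlgebra I)

/-- The normal fiber cone `⨁ₙ J n / 𝔪 J n`, where `J n` is the integral closure of `I ^ n`: the
closed fiber of the normal Rees algebra of `I`. -/
abbrev NormalFiberCone (I : Ideal R) : Type _ := ClosedFiber I.normalReesAlgebra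

/-- If `S = ⨁ₙ J n t ^ n`, then `𝔪 S = ⨁ₙ (𝔪 J n) t ^ n`. -/
theorem mem_map_maximalIdeal_iff {S : Subalgebra R R[X]} {J : ℕ → Ideal R}
    (hS : ∀ f, f ∈ S ↔ ∀ n, f.coeff n ∈ J n) (f : S) :
    f ∈ (maximalIdeal R).map (algebraMap R S) ↔
      ∀ n, (f : R[X]).coeff n ∈ maximalIdeal R * J n := by
  constructor
  · intro hf n
    induction hf using Submodule.span_induction with
    | mem g hg =>
      obtain ⟨r, hr, rfl⟩ := hg
      have h1 : (algebraMap R S r : R[X]).coeff n = r * (1 : R[X]).coeff n := by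
        rw [Subalgebra.coe_algebraMap, algebraMap_eq, ← mul_one (C r), coeff_C_mul]
      rw [h1]
      exact Ideal.mul_mem_mul hr ((hS 1).mp (one_mem S) n)
    | zero => simp
    | add g h _ _ hg hh => simpa using add_mem hg hh
    | smul a g hg' hg =>
      clear hg
      rw [smul_eq_mul]
      induction hg' using Submodule.span_induction generalizing a with
      | mem g hg =>
        obtain ⟨r, hr, rfl⟩ := hg
        rw [mul_comm a, MulMemClass.coe_mul, Subalgebra.coe_algebraMap, algebraMap_eq, coeff_C_mul]
        exact Ideal.mul_mem_mul hr ((hS a).mp a.2 n)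
      | zero => simp
      | add g h _ _ hg hh =>
        rw [mul_add, Subalgebra.coe_add, coeff_add]
        exact add_mem (hg a) (hh a)
      | smul b g _ hg =>
        rw [smul_eq_mul, ← mul_assoc]
        exact hg (a * b)
  · intro hf
    have key : ∀ n x, x ∈ maximalIdeal R * J n → ∃ h : monomial n x ∈ S,
        (⟨monomial n x, h⟩ : S) ∈ (maximalIdeal R).map (algebraMap R S) := by
      intro n x hx
      have hmon : ∀ y ∈ J n, (monomial n y : R[X]) ∈ S := fun y hy => by
        rw [hS]
        intro i
        rw [coeff_monomial]
        split_ifs with h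
        · exact h ▸ hy
        · exact zero_mem _
      induction hx using Submodule.mul_induction_on' with
      | mem_mul_mem r hr y hy =>
        refine ⟨hmon _ (Ideal.mul_mem_left _ _ hy), ?_⟩
        have : (⟨monomial n (r * y), hmon _ (Ideal.mul_mem_left _ _ hy)⟩ : S)
            = algebraMap R S r * ⟨monomial n y, hmon y hy⟩ := by
          ext1
          simp [← C_mul_monomial]
        rw [this]
        exact Ideal.mul_mem_right _ _ (Ideal.mem_map_of_mem _ hr)
      | add x _ y _ hx hy =>
        obtain ⟨h1, h1'⟩ := hx
        obtain ⟨h2, h2'⟩ := hy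
        refine ⟨by rw [map_add]; exact add_mem h1 h2, ?_⟩
        convert add_mem h1' h2' using 1
        ext1
        simp
    have : f = ∑ n ∈ (f : R[X]).support, ⟨_, (key n _ (hf n)).1⟩ := by
      ext1
      rw [AddSubmonoidClass.coe_finsetSum]
      exact (f : R[X]).as_sum_support
    rw [this]
    exact sum_mem fun n _ => (key n _ (hf n)).2

/-- If `S = ⨁ₙ J n t ^ n`, then the degree `n` part of the closed fiber of `S` is
`J n / 𝔪 J n`. -/
theorem ClosedFiber.nonempty_degreePart_equiv {S : Subalgebra R R[X]} {J : ℕ → Ideal R}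
    (hS : ∀ f, f ∈ S ↔ ∀ n, f.coeff n ∈ J n) (n : ℕ) :
    Nonempty ((J n ⧸ (maximalIdeal R • ⊤ : Submodule R (J n))) ≃ₗ[R] degreePart S n) := by
  have hmon : ∀ y ∈ J n, (monomial n y : R[X]) ∈ S := fun y hy => by
    rw [hS]
    intro i
    rw [coeff_monomial]
    split_ifs with h
    · exact h ▸ hy
    · exact zero_mem _
  let u : J n →ₗ[R] S :=
    { toFun := fun y => ⟨monomial n (y : R), hmon y y.2⟩
      map_add' := fun y z => by ext1; simp
      map_smul' := fun r y => by ext1; simp [smul_monomial] }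
  let pr : S →ₗ[R] ClosedFiber S :=
    (Ideal.Quotient.mkₐ R ((maximalIdeal R).map (algebraMap R S))).toLinearMap
  have hmem : ∀ y, pr (u y) ∈ degreePart S n := fun y => ⟨u y, ⟨(y : R), rfl⟩, rfl⟩
  let q : J n →ₗ[R] degreePart S n := (pr ∘ₗ u).codRestrict _ hmem
  have hq : Function.Surjective q := by
    rintro ⟨_, f, ⟨y, hy⟩, rfl⟩
    have hy' : (monomial n y : R[X]) = (f : R[X]) := hy
    have hyJ : y ∈ J n := by
      have := (hS f).mp f.2 n
      rwa [← hy', coeff_monomial_same] at this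
    refine ⟨⟨y, hyJ⟩, ?_⟩
    ext1
    exact congrArg pr (Subtype.ext hy')
  have hker : LinearMap.ker q = (maximalIdeal R • ⊤ : Submodule R (J n)) := by
    ext y
    have h1 : q y = 0 ↔ u y ∈ (maximalIdeal R).map (algebraMap R S) := by
      rw [← Ideal.Quotient.eq_zero_iff_mem, Subtype.ext_iff]
      rfl
    have h2 : y ∈ (maximalIdeal R • ⊤ : Submodule R (J n)) ↔ (y : R) ∈ maximalIdeal R * J n := by
      rw [Submodule.mem_smul_top_iff, smul_eq_mul]
    rw [LinearMap.mem_ker, h1, h2, mem_map_maximalIdeal_iff hS]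
    constructor
    · intro h
      simpa [u] using h n
    · intro h i
      change (monomial n (y : R) : R[X]).coeff i ∈ _
      rw [coeff_monomial]
      split_ifs with hi
      · exact hi ▸ h
      · exact zero_mem _
  exact ⟨(Submodule.quotEquivOfEq _ _ hker.symm).trans (q.quotKerEquivOfSurjective hq)⟩

end FiberCone

/-! ### Multiplicities -/

section Multiplicity

/-- The Krull dimension as a natural number (for rings of finite Krull dimension). -/
noncomputable def krullDimNat (A : Type*) [CommRing A] : ℕ :=
  ((ringKrullDim A).unbotD 0).toNat

/-- The multiplicity of a family `J` of ideals of `R`: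
`limsup d! ℓ(R / J n) / n ^ d` with `d = dim R`. It is the limit whenever the limit exists. -/
noncomputable def familyMultiplicity {R : Type*} [CommRing R] (J : ℕ → Ideal R) : ℝ≥0∞ :=
  limsup (fun n : ℕ =>
    ((krullDimNat R).factorial : ℝ≥0∞) * (Module.length R (R ⧸ J n) : ℝ≥0∞) / (n : ℝ≥0∞) ^ krullDimNat R)
    atTop

/-- The Hilbert–Samuel multiplicity `e(I)`. -/
noncomputable def samuelMultiplicity {R : Type*} [CommRing R] (I : Ideal R) : ℝ≥0∞ :=
  familyMultiplicity fun n => I ^ n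

/-- The normal multiplicity `ē(I)`. -/
noncomputable def normalMultiplicity {R : Type*} [CommRing R] (I : Ideal R) : ℝ≥0∞ :=
  familyMultiplicity fun n => (I ^ n).intClosure

/-- The multiplicity of a graded `R`-algebra `A` with degree `n` part `𝒜 n`:
`limsup (δ - 1)! ℓ(𝒜 n) / n ^ (δ - 1)` with `δ = dim A`. It is the limit whenever the limit
exists. -/
noncomputable def gradedMultiplicity {R A : Type*} [CommRing R] [CommRing A] [Algebra R A]
    (𝒜 : ℕ → Submodule R A) : ℝ≥0∞ :=
  limsup (fun n : ℕ =>
    ((krullDimNat A - 1).factorial : ℝ≥0∞) * (Module.length R (𝒜 n) : ℝ≥0∞) /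
      (n : ℝ≥0∞) ^ (krullDimNat A - 1)) atTop

variable {R : Type*} [CommRing R] [IsLocalRing R]

/-- The multiplicity `e(F(I))` of the fiber cone. -/
noncomputable def fiberConeMultiplicity (I : Ideal R) : ℝ≥0∞ :=
  gradedMultiplicity (R := R) (A := FiberCone I) (ClosedFiber.degreePart (reesAlgebra I))

/-- The multiplicity of the normal fiber cone of `I`. -/
noncomputable def normalFiberConeMultiplicity (I : Ideal R) : ℝ≥0∞ :=
  gradedMultiplicity (R := R) (A := NormalFiberCone I)
    (ClosedFiber.degreePart I.normalReesAlgebra)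

/-- The Loewy length of `R / I`: the smallest `n` with `𝔪 ^ n ⊆ I`. -/
noncomputable def loewyLength (I : Ideal R) : ℕ :=
  sInf {n : ℕ | maximalIdeal R ^ n ≤ I}

end Multiplicity

/-! Write `J` and `K` for the integral closures of `I ^ k` and `I ^ (k + 1)`, let `𝔪 ^ r ≤ I`, and
let `μ(L) = ℓ(L / 𝔪 L)`. Since `𝔪 ^ r * J ≤ I * J ≤ K`, the ideals `𝔪 ^ i * J + K` descend from `J`
to `K` in `r` steps. Each contains `𝔪` times its predecessor `L`, so each step costs at most `μ(L)`.
An integrally closed ideal of finite colength needs at least as many generators as any ideal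
containing it, so `μ(L) ≤ μ(K)` and `ℓ(R / K) ≤ ℓ(R / J) + r * μ(K)`. Summing over `k` and
normalizing by `n ^ d` gives the inequality, once the normal fiber cone is known to have dimension
at most `d`.

The comparison `μ(L) ≤ μ(K)` is classically proved with a general element `x` of `𝔪` satisfying `(𝔪
K : x) = K`, which requires an infinite residue field. Here `x` is replaced by a polynomial `f` with
content ideal `𝔪`. By Dedekind–Mertens and the determinant trick, if `f * g` has coefficients in `𝔪
K`, then `g` has coefficients in `K`. Multiplication by `f` on polynomials with `n` coefficients
then gives `n * ℓ(L / K) ≤ (n + deg f) * ℓ(𝔪 L / 𝔪 K)`, and large `n` removes the error `deg f`.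

For the dimension, the normal fiber cone is integral over the fiber cone. Noether normalization of
the latter, compared with `ℓ(R / I ^ n) = O(n ^ d)`, bounds its dimension by `d`. -/

namespace Polynomial

variable {R : Type*} [CommRing R]

/-! ### Content ideals and the Dedekind–Mertens lemma -/

theorem contentIdeal_le_iff {f : R[X]} {J : Ideal R} :
    f.contentIdeal ≤ J ↔ ∀ i, f.coeff i ∈ J := by
  refine ⟨fun h i => h (coeff_mem_contentIdeal f i), fun h => Ideal.span_le.mpr fun x hx => ?_⟩
  obtain ⟨n, -, rfl⟩ := mem_coeffs_iff.mp hx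
  exact h n

theorem contentIdeal_add_le (f g : R[X]) :
    (f + g).contentIdeal ≤ f.contentIdeal + g.contentIdeal :=
  contentIdeal_le_iff.mpr fun i => by
    rw [coeff_add]
    exact Submodule.add_mem_sup (coeff_mem_contentIdeal f i) (coeff_mem_contentIdeal g i)

theorem contentIdeal_erase_le (f : R[X]) (n : ℕ) : (f.erase n).contentIdeal ≤ f.contentIdeal :=
  contentIdeal_le_iff.mpr fun i => by
    rw [coeff_erase]
    split_ifs
    · exact zero_mem _
    · exact coeff_mem_contentIdeal f i

theorem contentIdeal_le_erase_add (f : R[X]) (n : ℕ) :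
    f.contentIdeal ≤ (f.erase n).contentIdeal + Ideal.span {f.coeff n} := by
  have h := contentIdeal_add_le (monomial n (f.coeff n)) (f.erase n)
  rwa [monomial_add_erase, contentIdeal_monomial, add_comm] at h

theorem contentIdeal_erase_mul_le (f g : R[X]) (n : ℕ) :
    (f.erase n * g).contentIdeal ≤
      (f * g).contentIdeal + Ideal.span {f.coeff n} * g.contentIdeal := by
  have h1 : f.erase n * g = f * g + monomial n (-f.coeff n) * g := by
    conv_rhs => rw [← monomial_add_erase f n]
    rw [monomial_neg]
    simp only [coeff_add, coeff_monomial, coeff_erase, if_true, add_zero]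
    ring
  rw [h1]
  refine (contentIdeal_add_le _ _).trans (add_le_add le_rfl ?_)
  refine (contentIdeal_mul_le_mul_contentIdeal _ _).trans ?_
  rw [contentIdeal_monomial, Ideal.span_singleton_neg]

theorem _root_.Ideal.add_pow_succ_le (P Q : Ideal R) (n : ℕ) :
    (P + Q) ^ (n + 1) ≤ P ^ (n + 1) + Q * (P + Q) ^ n := by
  induction n with
  | zero => simp
  | succ n ih =>
    calc (P + Q) ^ (n + 1 + 1) = P * (P + Q) ^ (n + 1) + Q * (P + Q) ^ (n + 1) := by ring
      _ ≤ P * (P ^ (n + 1) + Q * (P + Q) ^ n) + Q * (P + Q) ^ (n + 1) :=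
        add_le_add (Ideal.mul_mono_right ih) le_rfl
      _ = P ^ (n + 1 + 1) + (Q * (P * (P + Q) ^ n) + Q * (P + Q) ^ (n + 1)) := by ring
      _ ≤ _ := by
        refine add_le_add le_rfl (sup_le (Ideal.mul_mono_right ?_) le_rfl)
        rw [pow_succ' (P + Q)]
        exact Ideal.mul_mono_left le_sup_left

/-- The **Dedekind–Mertens lemma**. -/
theorem contentIdeal_pow_mul_contentIdeal_le (s : ℕ) : ∀ (t : ℕ) (f g : R[X]),
    (∀ i, s ≤ i → f.coeff i = 0) → (∀ i, t ≤ i → g.coeff i = 0) →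
    f.contentIdeal ^ t * g.contentIdeal ≤ f.contentIdeal ^ (t - 1) * (f * g).contentIdeal := by
  have hzero : ∀ f : R[X], (∀ i, 0 ≤ i → f.coeff i = 0) → f = 0 := fun f hf => by
    ext i; simpa using hf i (Nat.zero_le _)
  induction s with
  | zero =>
    intro t f g hf hg
    rcases t with _ | t
    · simp [hzero g hg]
    · simp [hzero f hf]
  | succ s ihs =>
    intro t
    induction t with
    | zero =>
      intro f g hf hg
      simp [hzero g hg]
    | succ t iht =>
      intro f g hf hg
      have hf' : ∀ i, s ≤ i → (f.erase s).coeff i = 0 := fun i hi => by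
        rw [coeff_erase]
        split_ifs
        · rfl
        · exact hf i (by omega)
      have hg' : ∀ i, t ≤ i → (g.erase t).coeff i = 0 := fun i hi => by
        rw [coeff_erase]
        split_ifs
        · rfl
        · exact hg i (by omega)
      -- The product of the formal leading coefficients is the coefficient of degree `s + t` of `f *
      -- g`.
      have hab : Ideal.span {f.coeff s} * Ideal.span {g.coeff t} ≤ (f * g).contentIdeal := by
        rw [Ideal.span_singleton_mul_span_singleton, Ideal.span_singleton_le_iff_mem,
          ← coeff_mul_add_eq_of_natDegree_le]
        · exact coeff_mem_contentIdeal _ _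
        · exact natDegree_le_iff_coeff_eq_zero.mpr fun i hi => hf i hi
        · exact natDegree_le_iff_coeff_eq_zero.mpr fun i hi => hg i hi
      have hA' := contentIdeal_erase_le f s
      have hA := contentIdeal_le_erase_add f s
      have hB := contentIdeal_le_erase_add g t
      have haA : Ideal.span {f.coeff s} ≤ f.contentIdeal :=
        (Ideal.span_singleton_le_iff_mem _).mpr (coeff_mem_contentIdeal f s)
      have hbB : Ideal.span {g.coeff t} ≤ g.contentIdeal :=
        (Ideal.span_singleton_le_iff_mem _).mpr (coeff_mem_contentIdeal g t)
      have hCf := contentIdeal_erase_mul_le f g s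
      have hCg := contentIdeal_erase_mul_le g f t
      have h1 := ihs (t + 1) (f.erase s) g hf' hg
      have h2 := iht f (g.erase t) hf hg'
      rw [mul_comm _ f, mul_comm g f] at hCg
      simp only [Nat.add_sub_cancel] at h1 ⊢
      generalize hB'e : (g.erase t).contentIdeal = B' at *
      generalize (f.erase s).contentIdeal = A' at *
      generalize (f * g.erase t).contentIdeal = C2 at *
      generalize (f.erase s * g).contentIdeal = C1 at *
      generalize (f * g).contentIdeal = C at *
      generalize Ideal.span {f.coeff s} = a at *
      generalize Ideal.span {g.coeff t} = b at *
      generalize f.contentIdeal = A at *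
      generalize g.contentIdeal = B at *
      have hab' : a * b * A ^ t ≤ A ^ t * C := by
        rw [mul_comm]; exact Ideal.mul_mono_right hab
      -- The factor `D ≤ A` restores the power of `A` lost in `A ^ (t - 1)`. For `t = 0` the
      -- subtraction truncates, but then `g.erase t` is zero.
      have h3 : ∀ D ≤ A, D * (A ^ t * B') ≤ A ^ t * C + D * b * A ^ t := by
        intro D hD
        rcases t with _ | t
        · have : B' = ⊥ := by rw [← hB'e, hzero _ hg', contentIdeal_zero]
          simp [this]
        · calc D * (A ^ (t + 1) * B') ≤ D * (A ^ t * (C + b * A)) :=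
              Ideal.mul_mono_right (h2.trans (Ideal.mul_mono_right hCg))
            _ = D * (A ^ t * C) + D * b * A ^ (t + 1) := by ring
            _ ≤ A * (A ^ t * C) + D * b * A ^ (t + 1) :=
              add_le_add (Ideal.mul_mono_left hD) le_rfl
            _ = _ := by ring
      have h4 : a * (A ^ t * B) ≤ A ^ t * C :=
        calc a * (A ^ t * B) ≤ a * (A ^ t * (B' + b)) :=
              Ideal.mul_mono_right (Ideal.mul_mono_right hB)
          _ = a * (A ^ t * B') + a * b * A ^ t := by ring
          _ ≤ A ^ t * C := sup_le ((h3 a haA).trans (sup_le le_rfl hab')) hab'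
      have h5 : A' ^ (t + 1) * B ≤ A ^ t * C :=
        calc A' ^ (t + 1) * B ≤ A' ^ t * (C + a * B) := h1.trans (Ideal.mul_mono_right hCf)
          _ ≤ A ^ t * (C + a * B) := Ideal.mul_mono_left (Ideal.pow_right_mono hA' t)
          _ = A ^ t * C + a * (A ^ t * B) := by ring
          _ ≤ A ^ t * C := sup_le le_rfl h4
      have hAe : A = A' + a := le_antisymm hA (sup_le hA' haA)
      -- Expanding `(A' + a) ^ (t + 1)`, every term except `A' ^ (t + 1)` contains `a`, and `a * b`
      -- is controlled by `hab`.
      have h6 : A ^ (t + 1) * b ≤ A ^ t * C := by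
        have h7 : A ^ (t + 1) ≤ A' ^ (t + 1) + a * A ^ t := by
          have := Ideal.add_pow_succ_le A' a t
          rwa [← hAe] at this
        calc A ^ (t + 1) * b ≤ (A' ^ (t + 1) + a * A ^ t) * b := Ideal.mul_mono_left h7
          _ = A' ^ (t + 1) * b + a * b * A ^ t := by ring
          _ ≤ A ^ t * C := sup_le ((Ideal.mul_mono_right hbB).trans h5) hab'
      calc A ^ (t + 1) * B ≤ A ^ (t + 1) * (B' + b) := Ideal.mul_mono_right hB
        _ = A * (A ^ t * B') + A ^ (t + 1) * b := by ring
        _ ≤ A ^ t * C := by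
          refine sup_le ((h3 A le_rfl).trans (sup_le le_rfl ?_)) h6
          rwa [mul_right_comm, ← pow_succ']

end Polynomial

/-! ### Integral closure and the determinant trick -/

namespace Ideal

variable {R : Type*} [CommRing R]

theorem le_intClosure (I : Ideal R) : I ≤ I.intClosure := fun x hx => by
  have h := mem_intClosure_pow_iff I 1 x
  rw [pow_one] at h
  rw [h]
  exact isIntegral_algebraMap (x := (⟨monomial 1 x, reesAlgebra.monomial_mem.mpr
    (by rwa [pow_one])⟩ : reesAlgebra I))

theorem intClosure_mono {I J : Ideal R} (h : I ≤ J) : I.intClosure ≤ J.intClosure :=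
  fun _ ⟨p, hp, hc, hx⟩ => ⟨p, hp, fun i => pow_right_mono h _ (hc i), hx⟩

theorem isIntegral_of_mem_reesAlgebra_intClosure {I : Ideal R} {f : R[X]}
    (hf : f ∈ reesAlgebra I.intClosure) : IsIntegral (reesAlgebra I) f := by
  have h : reesAlgebra I.intClosure ≤
      (integralClosure (reesAlgebra I) R[X]).restrictScalars R := by
    rw [← adjoin_monomial_eq_reesAlgebra]
    refine Algebra.adjoin_le ?_
    rintro _ ⟨x, hx, rfl⟩
    have := mem_intClosure_pow_iff I 1 x
    rw [pow_one] at this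
    exact this.mp hx
  exact h hf

/-- Integral closure of ideals is idempotent. -/
theorem intClosure_intClosure (I : Ideal R) : I.intClosure.intClosure = I.intClosure := by
  refine le_antisymm (fun x hx => ?_) (le_intClosure _)
  have h1 := mem_intClosure_pow_iff I.intClosure 1 x
  have h2 := mem_intClosure_pow_iff I 1 x
  rw [pow_one] at h1 h2
  rw [h1] at hx
  rw [h2]
  let S := integralClosure (reesAlgebra I) R[X]
  have hx' : IsIntegral S (monomial 1 x : R[X]) := by
    obtain ⟨q, hq, hqx⟩ := hx
    let φ : reesAlgebra I.intClosure →+* S :=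
      (reesAlgebra I.intClosure).val.toRingHom.codRestrict S.toSubring fun f =>
        isIntegral_of_mem_reesAlgebra_intClosure f.2
    refine ⟨q.map φ, hq.map φ, ?_⟩
    rw [eval₂_map]
    exact hqx
  exact isIntegral_trans _ hx'

/-- The determinant trick for ideals. -/
theorem exists_monic_of_span_singleton_mul_le {K M : Ideal R} (hM : M.FG) {y : R}
    (h : span {y} * M ≤ K * M) :
    ∃ p : R[X], p.Monic ∧ (∀ i, p.coeff i ∈ K ^ (p.natDegree - i)) ∧
      ∀ x ∈ M, p.eval y * x = 0 := by
  have : Module.Finite R M := Module.Finite.iff_fg.mpr hM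
  obtain ⟨p, hp, -, hc, hpy⟩ :=
    LinearMap.exists_monic_and_natDegree_eq_and_coeff_mem_pow_and_aeval_eq_zero R
      (algebraMap R (Module.End R M) y) K (by
        rintro _ ⟨x, rfl⟩
        rw [Submodule.mem_smul_top_iff, smul_eq_mul]
        exact h (mul_mem_mul (mem_span_singleton_self y) x.2))
  refine ⟨p, hp, hc, fun x hx => ?_⟩
  rw [aeval_algebraMap_apply, Polynomial.coe_aeval_eq_eval] at hpy
  have := congrArg (fun u : Module.End R M => (u ⟨x, hx⟩ : R)) hpy
  simpa [Module.algebraMap_end_apply] using this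

/-- The polynomial `p * X ^ N` is an equation of integral dependence. This turns "`p(y)` kills `𝔪 ^
N`", which is all the determinant trick gives, into integrality of `y ∈ 𝔪`. -/
theorem mem_intClosure_of_monic_mul_pow {K : Ideal R} {p : R[X]} (hp : p.Monic)
    (hc : ∀ i, p.coeff i ∈ K ^ (p.natDegree - i)) {y : R} (N : ℕ) (h : p.eval y * y ^ N = 0) :
    y ∈ K.intClosure := by
  refine ⟨p * X ^ N, hp.mul (monic_X_pow N), fun i => ?_, by simpa using h⟩
  rcases subsingleton_or_nontrivial R with hR | hR
  · exact (Subsingleton.elim 0 ((p * X ^ N).coeff i)) ▸ Submodule.zero_mem _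
  rw [hp.natDegree_mul (monic_X_pow N), natDegree_X_pow, coeff_mul_X_pow']
  split_ifs with hi
  · have := hc (i - N)
    rwa [show p.natDegree - (i - N) = p.natDegree + N - i by omega] at this
  · exact zero_mem _

/-- Generators of `J` are taken as coefficients. For `J = 𝔪` the polynomial plays the role of a
general element of `𝔪`. -/
theorem exists_contentIdeal_eq {J : Ideal R} (hJ : J.FG) : ∃ f : R[X], f.contentIdeal = J := by
  obtain ⟨n, v, rfl⟩ := Submodule.fg_iff_exists_fin_generating_family.mp hJ
  refine ⟨∑ i : Fin n, monomial (i : ℕ) (v i), le_antisymm (contentIdeal_le_iff.mpr fun i => ?_) ?_⟩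
  · rw [finsetSum_coeff]
    refine Ideal.sum_mem _ fun j _ => ?_
    rw [coeff_monomial]
    split_ifs
    · exact subset_span ⟨j, rfl⟩
    · exact zero_mem _
  · rw [span_le]
    rintro _ ⟨j, rfl⟩
    have := coeff_mem_contentIdeal (∑ i : Fin n, monomial (i : ℕ) (v i)) j
    simpa [coeff_monomial, Fin.val_inj] using this

variable [IsLocalRing R] [IsNoetherianRing R]

theorem mem_intClosure_of_mul_maximalIdeal_pow_le (hdim : 0 < ringKrullDim R) {K : Ideal R}
    {y : R} {N : ℕ} (h : span {y} * maximalIdeal R ^ N ≤ K * maximalIdeal R ^ N) :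
    y ∈ K.intClosure := by
  by_cases hK : K = ⊤
  · exact le_intClosure K (hK ▸ Submodule.mem_top)
  by_cases hy : y ∈ maximalIdeal R
  · obtain ⟨p, hp, hc, hz⟩ := exists_monic_of_span_singleton_mul_le (IsNoetherian.noetherian _) h
    exact mem_intClosure_of_monic_mul_pow hp hc N (hz _ (pow_mem_pow hy N))
  -- If `y` is a unit, then `𝔪 ^ N ≤ K * 𝔪 ^ N` with `K` proper. Nakayama gives `𝔪 ^ N = 0`, so `R`
  -- is Artinian, against positive dimension.
  · exfalso
    have hu : IsUnit y := by simpa using hy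
    rw [span_singleton_eq_top.mpr hu, top_mul] at h
    have h0 : maximalIdeal R ^ N = ⊥ :=
      Submodule.eq_bot_of_le_smul_of_le_jacobson_bot K _ (IsNoetherian.noetherian _) h
        ((le_maximalIdeal hK).trans (maximalIdeal_le_jacobson _))
    have hA := (isArtinianRing_iff_isNilpotent_maximalIdeal R).mpr ⟨N, h0⟩
    rw [isArtinianRing_iff_krullDimLE_zero, Ring.krullDimLE_iff] at hA
    exact absurd hdim (not_lt.mpr (by simpa using hA))

/-- A generic linear combination of generators of the maximal ideal is a nonzerodivisor in the
sense needed for `𝔪`-fullness of integrally closed ideals. -/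
theorem coeff_mem_intClosure_of_coeff_mul_mem (hdim : 0 < ringKrullDim R) {K : Ideal R}
    {f g : R[X]} (hf : f.contentIdeal = maximalIdeal R)
    (h : ∀ i, (f * g).coeff i ∈ maximalIdeal R * K) (i : ℕ) : g.coeff i ∈ K.intClosure := by
  -- With `t = deg g + 1`, this gives `𝔪 ^ t * c(g) ≤ 𝔪 ^ (t - 1) * c(f * g) ≤ K * 𝔪 ^ t`, the input
  -- of the determinant trick on `𝔪 ^ t`.
  have hDM := contentIdeal_pow_mul_contentIdeal_le (f.natDegree + 1) (g.natDegree + 1) f g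
    (fun i hi => coeff_eq_zero_of_natDegree_lt hi) (fun i hi => coeff_eq_zero_of_natDegree_lt hi)
  rw [hf, Nat.add_sub_cancel] at hDM
  refine mem_intClosure_of_mul_maximalIdeal_pow_le (N := g.natDegree + 1) hdim ?_
  calc span {g.coeff i} * maximalIdeal R ^ (g.natDegree + 1)
      ≤ maximalIdeal R ^ (g.natDegree + 1) * g.contentIdeal := by
        rw [mul_comm]
        exact mul_mono_right ((span_singleton_le_iff_mem _).mpr (coeff_mem_contentIdeal g i))
    _ ≤ maximalIdeal R ^ g.natDegree * (maximalIdeal R * K) :=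
        hDM.trans (mul_mono_right (contentIdeal_le_iff.mpr h))
    _ = K * maximalIdeal R ^ (g.natDegree + 1) := by ring

end Ideal

/-! ### Length inequalities -/

namespace Module

variable {R : Type*} [CommRing R]

/-- `C` is a quotient of `A / ker g`, which embeds in `B`; no map between `B` and `C` has to be
constructed. -/
theorem length_le_of_ker_le {A B C : Type*} [AddCommGroup A] [Module R A] [AddCommGroup B]
    [Module R B] [AddCommGroup C] [Module R C] (g : A →ₗ[R] B) (p : A →ₗ[R] C)
    (hp : Function.Surjective p) (h : LinearMap.ker g ≤ LinearMap.ker p) :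
    length R C ≤ length R B := by
  have h1 : length R C ≤ length R (A ⧸ LinearMap.ker g) :=
    length_le_of_surjective ((LinearMap.ker g).liftQ p h) (fun c => by
      obtain ⟨a, rfl⟩ := hp c
      exact ⟨Submodule.Quotient.mk a, by simp⟩)
  rw [g.quotKerEquivRange.length_eq] at h1
  exact h1.trans (length_le_of_injective _ (Submodule.subtype_injective _))

theorem length_quotient_mono {M : Type*} [AddCommGroup M] [Module R M] {P Q : Submodule R M}
    (h : P ≤ Q) : length R (M ⧸ Q) ≤ length R (M ⧸ P) :=
  length_le_of_surjective (Submodule.factor h) (Submodule.factor_surjective h)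

theorem length_quotient_eq_add {M : Type*} [AddCommGroup M] [Module R M] {P Q : Submodule R M}
    (h : P ≤ Q) :
    length R (M ⧸ P) = length R (M ⧸ Q) + length R (Q ⧸ P.submoduleOf Q) := by
  have hker : P.submoduleOf Q = LinearMap.ker (P.mkQ ∘ₗ Q.subtype) := by
    rw [LinearMap.ker_comp, Submodule.ker_mkQ, Submodule.submoduleOf]
  rw [length_eq_add_of_exact ((P.submoduleOf Q).liftQ (P.mkQ ∘ₗ Q.subtype) hker.le)
    (P.liftQ Q.mkQ (h.trans Q.ker_mkQ.ge)) ?_ ?_ ?_, add_comm]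
  · exact LinearMap.ker_eq_bot.mp (Submodule.ker_liftQ_eq_bot' _ _ hker)
  · intro x
    obtain ⟨x, rfl⟩ := Submodule.mkQ_surjective _ x
    exact ⟨P.mkQ x, by simp⟩
  · intro x
    obtain ⟨x, rfl⟩ := Submodule.mkQ_surjective _ x
    constructor
    · intro hx
      have : x ∈ Q := by simpa using hx
      exact ⟨Submodule.Quotient.mk ⟨x, this⟩, by simp⟩
    · rintro ⟨y, hy⟩
      obtain ⟨y, rfl⟩ := Submodule.mkQ_surjective _ y
      rw [← hy]
      simp

end Module

theorem ENat.le_of_forall_nat_mul_le {a b : ℕ∞} {s : ℕ}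
    (h : ∀ n : ℕ, n * a ≤ ((n + s : ℕ) : ℕ∞) * b) : a ≤ b := by
  induction b using ENat.recTopCoe with
  | top => exact le_top
  | coe b =>
    by_contra! hab
    have h1 : ((b + 1 : ℕ) : ℕ∞) ≤ a := by
      push_cast
      exact Order.add_one_le_of_lt hab
    -- For `n = s * b + 1` the two sides differ by exactly one: `(s * b + 1) * (b + 1) = (s * b + 1
    -- + s) * b + 1`.
    have h2 := (mul_le_mul_right h1 ((s * b + 1 : ℕ) : ℕ∞)).trans (h (s * b + 1))
    norm_cast at h2
    nlinarith

/-! ### Numbers of generators of ideals above an integrally closed ideal -/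

namespace Ideal

variable {R : Type*} [CommRing R] [IsLocalRing R]

theorem length_quotient_mul_maximalIdeal (J : Ideal R) :
    Module.length R (R ⧸ maximalIdeal R * J) = Module.length R (R ⧸ J) +
      Module.length R (J ⧸ (maximalIdeal R • ⊤ : Submodule R J)) := by
  rw [Module.length_quotient_eq_add (mul_le_right : maximalIdeal R * J ≤ J)]
  have : (maximalIdeal R * J).submoduleOf J = (maximalIdeal R • ⊤ : Submodule R J) := by
    ext y
    rw [Submodule.mem_smul_top_iff, smul_eq_mul]
    rfl
  rw [this]

variable [IsNoetherianRing R]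

/-- If `K` is integrally closed and `K ≤ L`, then `ℓ(L / K) ≤ ℓ(𝔪 L / 𝔪 K)`. -/
theorem length_quotient_le_of_intClosure_eq (hdim : 0 < ringKrullDim R) {K L : Ideal R}
    (hK : K.intClosure = K) :
    Module.length R (L ⧸ K.submoduleOf L) ≤
      Module.length R (↥(maximalIdeal R * L) ⧸
        (maximalIdeal R * K).submoduleOf (maximalIdeal R * L)) := by
  obtain ⟨f, hf⟩ := exists_contentIdeal_eq (IsNoetherian.noetherian (maximalIdeal R))
  -- Multiplication by `f` sends polynomials with `n` coefficients in `L` to polynomials with `n +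
  -- deg f` coefficients in `𝔪 L`. The map `g` reduces the result modulo `𝔪 K`, and its kernel
  -- consists of polynomials with coefficients in `K`.
  refine ENat.le_of_forall_nat_mul_le (s := f.natDegree) fun n => ?_
  let poly : (Fin n → L) →ₗ[R] R[X] :=
    ∑ i : Fin n, monomial (i : ℕ) ∘ₗ L.subtype ∘ₗ LinearMap.proj i
  have hpoly : ∀ a i, (poly a).coeff i ∈ L := fun a i => by
    simp only [poly, LinearMap.sum_apply, finsetSum_coeff]
    refine Ideal.sum_mem _ fun j _ => ?_
    simp only [LinearMap.comp_apply, coeff_monomial]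
    split_ifs
    · exact (a j).2
    · exact zero_mem _
  have hpoly' : ∀ a (i : Fin n), (poly a).coeff i = a i := fun a i => by
    simp [poly, coeff_monomial, Fin.val_inj]
  have hdeg : ∀ a i, n ≤ i → (poly a).coeff i = 0 := fun a i hi => by
    simp only [poly, LinearMap.sum_apply, finsetSum_coeff]
    refine Finset.sum_eq_zero fun j _ => ?_
    simp only [LinearMap.comp_apply, coeff_monomial]
    rw [if_neg (by omega)]
  have hmul : ∀ a i, (f * poly a).coeff i ∈ maximalIdeal R * L := fun a i => by
    rw [coeff_mul]
    exact Ideal.sum_mem _ fun x _ => mul_mem_mul (hf ▸ coeff_mem_contentIdeal f _) (hpoly a _)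
  let g : (Fin n → L) →ₗ[R] (Fin (n + f.natDegree) → ↥(maximalIdeal R * L) ⧸
      (maximalIdeal R * K).submoduleOf (maximalIdeal R * L)) :=
    LinearMap.pi fun i => Submodule.mkQ _ ∘ₗ
      ((lcoeff R i ∘ₗ LinearMap.mulLeft R f ∘ₗ poly).codRestrict _ fun a => hmul a i)
  let p : (Fin n → L) →ₗ[R] (Fin n → L ⧸ K.submoduleOf L) :=
    LinearMap.pi fun i => Submodule.mkQ _ ∘ₗ LinearMap.proj i
  have hp : Function.Surjective p := fun c => by
    choose a ha using fun i => Submodule.mkQ_surjective _ (c i)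
    exact ⟨a, funext ha⟩
  have := Module.length_le_of_ker_le g p hp fun a ha => ?_
  · simpa using this
  rw [LinearMap.mem_ker] at ha ⊢
  -- The entries of `g a` control the coefficients of index below `n + deg f`; the others vanish for
  -- degree reasons.
  have hcoeff : ∀ i, (f * poly a).coeff i ∈ maximalIdeal R * K := fun i => by
    by_cases hi : i < n + f.natDegree
    · have h1 : Submodule.mkQ ((maximalIdeal R * K).submoduleOf (maximalIdeal R * L))
          ⟨(f * poly a).coeff i, hmul a i⟩ = 0 := congrFun ha ⟨i, hi⟩
      rw [Submodule.mkQ_apply, Submodule.Quotient.mk_eq_zero] at h1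
      exact h1
    · rw [coeff_mul]
      refine Ideal.sum_mem _ fun x hx => ?_
      have hx' := Finset.HasAntidiagonal.mem_antidiagonal.mp hx
      by_cases h1 : n ≤ x.2
      · rw [hdeg a _ h1, mul_zero]
        exact zero_mem _
      · rw [coeff_eq_zero_of_natDegree_lt (p := f) (by omega), zero_mul]
        exact zero_mem _
  funext i
  change Submodule.mkQ (K.submoduleOf L) (a i) = 0
  rw [Submodule.mkQ_apply, Submodule.Quotient.mk_eq_zero]
  change (a i : R) ∈ K
  have := coeff_mem_intClosure_of_coeff_mul_mem hdim hf hcoeff i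
  rwa [hpoly', hK] at this

/-- An integrally closed ideal of finite colength has at least as many generators as any ideal
containing it. -/
theorem length_quotient_smul_le_of_intClosure_eq (hdim : 0 < ringKrullDim R) {K L : Ideal R}
    (hK : K.intClosure = K) (hKL : K ≤ L) (hfin : Module.length R (R ⧸ K) ≠ ⊤) :
    Module.length R (L ⧸ (maximalIdeal R • ⊤ : Submodule R L)) ≤
      Module.length R (K ⧸ (maximalIdeal R • ⊤ : Submodule R K)) := by
  have h1 := length_quotient_mul_maximalIdeal K
  have h2 := length_quotient_mul_maximalIdeal L
  have h3 := Module.length_quotient_eq_add hKL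
  have h4 := Module.length_quotient_eq_add (mul_mono_right hKL : maximalIdeal R * K ≤ _)
  have h5 := length_quotient_le_of_intClosure_eq hdim (L := L) hK
  -- Computing `ℓ(R / 𝔪 K)` through `K` and through `𝔪 L` gives `ℓ(R/L) + μ(L) + ℓ(𝔪L/𝔪K) = ℓ(R/L) +
  -- ℓ(L/K) + μ(K)`. Finite colength of `K` permits the cancellations.
  rw [h4, h2, h3] at h1
  generalize Module.length R (L ⧸ K.submoduleOf L) = a at *
  generalize Module.length R (R ⧸ L) = l at *
  rw [add_assoc, add_assoc] at h1
  have hl : l ≠ ⊤ := fun h => hfin (by rw [h3, h, top_add])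
  have ha : a ≠ ⊤ := fun h => hfin (by rw [h3, h, add_top])
  have h6 := ENat.add_right_injective_of_ne_top hl h1
  refine ENat.addLECancellable_of_ne_top ha ?_
  rw [← h6, add_comm]
  gcongr

end Ideal

/-! ### Colengths of the integral closures of powers -/

namespace Ideal

variable {R : Type*} [CommRing R]

theorem mul_intClosure_pow_le (I : Ideal R) (k : ℕ) :
    I * (I ^ k).intClosure ≤ (I ^ (k + 1)).intClosure := by
  refine mul_le.mpr fun x hx y hy => ?_
  have hx' : x ∈ (I ^ 1).intClosure := le_intClosure _ (by rwa [pow_one])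
  rw [mem_intClosure_pow_iff] at hx' hy ⊢
  have := hx'.mul hy
  rwa [monomial_mul_monomial, add_comm] at this

variable [IsLocalRing R] [IsNoetherianRing R]

theorem length_quotient_ne_top_of_pow_le {J : Ideal R} {N : ℕ} (h : maximalIdeal R ^ N ≤ J) :
    Module.length R (R ⧸ J) ≠ ⊤ := by
  refine ne_top_of_le_ne_top ?_ (Module.length_quotient_mono h)
  clear h
  induction N with
  | zero =>
    have : Subsingleton (R ⧸ maximalIdeal R ^ 0) := by
      rw [pow_zero]; exact Submodule.Quotient.subsingleton_iff.mpr one_eq_top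
    rw [Module.length_eq_zero]
    exact ENat.zero_ne_top
  | succ N ih =>
    rw [pow_succ', length_quotient_mul_maximalIdeal]
    refine WithTop.add_ne_top.mpr ⟨ih, ?_⟩
    let M := ↥(maximalIdeal R ^ N)
    obtain ⟨n, g, hg⟩ := Module.Finite.exists_fin' R M
    -- For `M = 𝔪 ^ N`, the quotient `M / 𝔪 M` is an image of a finite power of the residue field.
    have h1 : Module.length R (M ⧸ (maximalIdeal R • ⊤ : Submodule R M)) ≤
        Module.length R (Fin n → IsLocalRing.ResidueField R) := by
      refine Module.length_le_of_ker_le (A := Fin n → R)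
        (LinearMap.pi fun i => Algebra.linearMap R (IsLocalRing.ResidueField R) ∘ₗ LinearMap.proj i)
        (Submodule.mkQ _ ∘ₗ g) ((Submodule.mkQ_surjective _).comp hg) fun a ha => ?_
      have ha' : ∀ i, a i ∈ maximalIdeal R := fun i => by
        rw [← residue_eq_zero_iff]
        exact congrFun ha i
      rw [LinearMap.mem_ker, LinearMap.comp_apply, Submodule.mkQ_apply,
        Submodule.Quotient.mk_eq_zero, pi_eq_sum_univ a, map_sum]
      refine Submodule.sum_mem _ fun i _ => ?_
      rw [map_smul]
      exact Submodule.smul_mem_smul (ha' i) trivial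
    refine ne_top_of_le_ne_top ?_ h1
    have : IsSimpleModule R (IsLocalRing.ResidueField R) :=
      isSimpleModule_iff_quot_maximal.mpr ⟨maximalIdeal R, inferInstance, ⟨.refl _ _⟩⟩
    rw [Module.length_pi, Module.length_eq_one, mul_one, ENat.card_eq_coe_fintype_card]
    exact ENat.natCast_ne_top _

theorem length_quotient_intClosure_pow_succ_le (hdim : 0 < ringKrullDim R) {I : Ideal R} {r : ℕ}
    (hr : maximalIdeal R ^ r ≤ I) (k : ℕ) :
    Module.length R (R ⧸ (I ^ (k + 1)).intClosure) ≤ Module.length R (R ⧸ (I ^ k).intClosure) +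
      r * Module.length R ((I ^ (k + 1)).intClosure ⧸
        (maximalIdeal R • ⊤ : Submodule R (I ^ (k + 1)).intClosure)) := by
  have hKJ : (I ^ (k + 1)).intClosure ≤ (I ^ k).intClosure :=
    intClosure_mono (pow_le_pow_right (by omega))
  have hfin : Module.length R (R ⧸ (I ^ (k + 1)).intClosure) ≠ ⊤ := by
    refine length_quotient_ne_top_of_pow_le (N := r * (k + 1)) ?_
    rw [pow_mul]
    exact (pow_right_mono hr _).trans (le_intClosure _)
  have hrJ : maximalIdeal R ^ r * (I ^ k).intClosure ≤ (I ^ (k + 1)).intClosure :=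
    (mul_mono_left hr).trans (mul_intClosure_pow_le I k)
  have hK := intClosure_intClosure (I ^ (k + 1))
  generalize (I ^ (k + 1)).intClosure = K at *
  generalize (I ^ k).intClosure = J at *
  -- The chain `𝔪 ^ i * J + K` stays above `K`, so each step costs at most `μ(K)`. At `i = r` it has
  -- reached `K`.
  have key : ∀ i : ℕ, Module.length R (R ⧸ (maximalIdeal R ^ i * J + K)) ≤
      Module.length R (R ⧸ J) + i * Module.length R (K ⧸ (maximalIdeal R • ⊤ : Submodule R K)) := by
    intro i
    induction i with
    | zero =>
      refine le_add_right (Module.length_quotient_mono ?_)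
      rw [pow_zero, one_mul]
      exact le_sup_left
    | succ i ih =>
      have h1 : maximalIdeal R * (maximalIdeal R ^ i * J + K) ≤ maximalIdeal R ^ (i + 1) * J + K := by
        rw [mul_add, ← mul_assoc, ← pow_succ']
        exact add_le_add le_rfl mul_le_right
      refine (Module.length_quotient_mono h1).trans ?_
      rw [length_quotient_mul_maximalIdeal]
      push_cast
      rw [add_mul, one_mul, ← add_assoc]
      exact add_le_add ih
        (length_quotient_smul_le_of_intClosure_eq hdim hK le_sup_right hfin)
  refine (Module.length_quotient_mono ?_).trans (key r)
  exact sup_le hrJ le_rfl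

theorem length_quotient_intClosure_pow_le_sum (hdim : 0 < ringKrullDim R) {I : Ideal R} {r : ℕ}
    (hr : maximalIdeal R ^ r ≤ I) (n : ℕ) :
    Module.length R (R ⧸ (I ^ n).intClosure) ≤ r * ∑ k ∈ Finset.range n,
      Module.length R ((I ^ (k + 1)).intClosure ⧸
        (maximalIdeal R • ⊤ : Submodule R (I ^ (k + 1)).intClosure)) := by
  induction n with
  | zero =>
    have : (I ^ 0).intClosure = ⊤ := by
      rw [pow_zero, one_eq_top]
      exact top_le_iff.mp (le_intClosure _)
    have : Subsingleton (R ⧸ (I ^ 0).intClosure) :=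
      Submodule.Quotient.subsingleton_iff.mpr this
    rw [Module.length_eq_zero]
    exact bot_le
  | succ n ih =>
    rw [Finset.sum_range_succ, mul_add]
    exact (length_quotient_intClosure_pow_succ_le hdim hr n).trans (add_le_add ih le_rfl)

end Ideal

/-! ### Growth of the Hilbert–Samuel function -/

namespace Ideal

variable {R : Type*} [CommRing R]

/-- The quotient `(J + (x)) / (J + (x * y))` is generated by the class of `x` and killed by `J +
(y)`, hence is an image of `R / (J + (y))`. -/
theorem length_quotient_sup_span_mul_le (J : Ideal R) (x y : R) :
    Module.length R (R ⧸ J ⊔ span {x * y}) ≤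
      Module.length R (R ⧸ J ⊔ span {x}) + Module.length R (R ⧸ J ⊔ span {y}) := by
  have hPQ : J ⊔ span {x * y} ≤ J ⊔ span {x} :=
    sup_le_sup_left (span_singleton_le_span_singleton.mpr (dvd_mul_right x y)) J
  rw [Module.length_quotient_eq_add hPQ]
  refine add_le_add le_rfl ?_
  have hx : x ∈ J ⊔ span {x} := le_sup_right (a := J) (mem_span_singleton_self x)
  refine Module.length_le_of_ker_le (Submodule.mkQ (J ⊔ span {y}))
    (Submodule.mkQ _ ∘ₗ LinearMap.toSpanSingleton R ↥(J ⊔ span {x}) ⟨x, hx⟩) ?_ ?_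
  · intro c
    obtain ⟨⟨c, hc⟩, rfl⟩ := Submodule.mkQ_surjective _ c
    obtain ⟨j, hj, z, hz, rfl⟩ := Submodule.mem_sup.mp hc
    obtain ⟨r, rfl⟩ := mem_span_singleton'.mp hz
    refine ⟨r, ?_⟩
    rw [LinearMap.comp_apply, ← sub_eq_zero, ← map_sub, Submodule.mkQ_apply,
      Submodule.Quotient.mk_eq_zero]
    change r * x - (j + r * x) ∈ J ⊔ span {x * y}
    rw [sub_add_cancel_right]
    exact neg_mem (le_sup_left (a := J) hj)
  · rw [Submodule.ker_mkQ]
    intro r hr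
    obtain ⟨j, hj, z, hz, rfl⟩ := Submodule.mem_sup.mp hr
    obtain ⟨r, rfl⟩ := mem_span_singleton'.mp hz
    rw [LinearMap.mem_ker, LinearMap.comp_apply, Submodule.mkQ_apply,
      Submodule.Quotient.mk_eq_zero]
    change (j + r * y) * x ∈ J ⊔ span {x * y}
    rw [add_mul]
    exact add_mem (le_sup_left (a := J) (J.mul_mem_right x hj))
      (le_sup_right (a := J) (mem_span_singleton'.mpr ⟨r, by ring⟩))

theorem length_quotient_sup_span_pow_le (J : Ideal R) (x : R) (n : ℕ) :
    Module.length R (R ⧸ J ⊔ span {x ^ n}) ≤ n * Module.length R (R ⧸ J ⊔ span {x}) := by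
  induction n with
  | zero =>
    have : Subsingleton (R ⧸ J ⊔ span {x ^ 0}) :=
      Submodule.Quotient.subsingleton_iff.mpr (by simp)
    rw [Module.length_eq_zero]
    exact bot_le
  | succ n ih =>
    rw [pow_succ]
    refine (length_quotient_sup_span_mul_le J _ x).trans ?_
    push_cast
    rw [add_mul, one_mul]
    exact add_le_add ih le_rfl

/-- Generators are replaced by their powers one at a time, each at the cost of a factor `n`. `J`
stays arbitrary so that it can absorb the power of the inserted generator. -/
theorem length_quotient_sup_span_image_pow_le (s : Finset R) (n : ℕ) (J : Ideal R) :
    Module.length R (R ⧸ J ⊔ span ((· ^ n) '' (s : Set R))) ≤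
      (n : ℕ∞) ^ s.card * Module.length R (R ⧸ J ⊔ span (s : Set R)) := by
  classical
  induction s using Finset.induction_on generalizing J with
  | empty => rw [Finset.coe_empty, Set.image_empty, Finset.card_empty, pow_zero, one_mul]
  | insert a s ha ih =>
    have e1 : J ⊔ span ((· ^ n) '' (↑(insert a s) : Set R)) =
        (J ⊔ span {a ^ n}) ⊔ span ((· ^ n) '' (s : Set R)) := by
      rw [Finset.coe_insert, Set.image_insert_eq, span_insert, sup_assoc]
    have e2 : J ⊔ span (↑(insert a s) : Set R) = (J ⊔ span (s : Set R)) ⊔ span {a} := by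
      rw [Finset.coe_insert, span_insert, sup_comm (span {a}), sup_assoc]
    have h1 := ih (J ⊔ span {a ^ n})
    have h2 := length_quotient_sup_span_pow_le (J ⊔ span (s : Set R)) a n
    rw [sup_right_comm] at h2
    rw [Finset.card_insert_of_notMem ha, e1, e2, pow_succ, mul_assoc]
    exact h1.trans (mul_le_mul_right h2 _)

variable [IsLocalRing R] [IsNoetherianRing R]

/-- A Noetherian local ring has finite dimension, so no default value of `krullDimNat` intervenes.
-/
theorem _root_.natCast_krullDimNat : ((krullDimNat R : ℕ) : WithBot ℕ∞) = ringKrullDim R := by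
  obtain ⟨n, hn⟩ := ENat.ne_top_iff_exists.mp (height_ne_top (IsPrime.ne_top' (I := maximalIdeal R)))
  rw [krullDimNat, ← maximalIdeal_height_eq_ringKrullDim, ← hn]
  simp

/-- The Hilbert–Samuel function of an ideal of finite colength grows at most like
`n ^ dim R`. -/
theorem exists_length_quotient_pow_le {I : Ideal R} {r : ℕ} (hr : maximalIdeal R ^ r ≤ I) :
    ∃ C : ℕ, ∀ n : ℕ, Module.length R (R ⧸ I ^ n) ≤ ((C * n ^ krullDimNat R : ℕ) : ℕ∞) := by
  -- `s` is a system of parameters: `dim R` elements over which `𝔪` is minimal, so that they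
  -- generate an ideal with radical `𝔪`.
  obtain ⟨s, hs, hcard⟩ := exists_finset_card_eq_height_of_isNoetherianRing (maximalIdeal R)
  have hcard' : s.card = krullDimNat R := by
    have h := natCast_krullDimNat (R := R)
    rw [← maximalIdeal_height_eq_ringKrullDim, ← hcard] at h
    exact_mod_cast h.symm
  have hrad : (span (s : Set R)).radical = maximalIdeal R := by
    rw [radical_eq_sInf]
    refine le_antisymm (sInf_le ⟨hs.1.2, inferInstance⟩) (le_sInf ?_)
    rintro q ⟨hq, hq'⟩
    exact hs.2 ⟨hq', hq⟩ (le_maximalIdeal hq'.ne_top)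
  obtain ⟨N, hN⟩ := exists_radical_pow_le_of_fg (span (s : Set R)) (IsNoetherian.noetherian _)
  rw [hrad] at hN
  obtain ⟨c, hc⟩ := ENat.ne_top_iff_exists.mp (length_quotient_ne_top_of_pow_le hN)
  -- The `(r * n)`-th powers of the parameters lie in `𝔪 ^ (r * n) ≤ I ^ n` and generate an ideal of
  -- colength at most `(r * n) ^ d * c`.
  refine ⟨r ^ krullDimNat R * c, fun n => ?_⟩
  have h1 : span ((· ^ (r * n)) '' (s : Set R)) ≤ I ^ n := by
    rw [span_le]
    rintro _ ⟨x, hx, rfl⟩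
    have := pow_right_mono hr n
    rw [← pow_mul] at this
    exact this (pow_mem_pow (hs.1.2 (subset_span hx)) _)
  have h2 := length_quotient_sup_span_image_pow_le s (r * n) ⊥
  rw [bot_sup_eq, bot_sup_eq, ← hc, hcard'] at h2
  refine (Module.length_quotient_mono h1).trans (h2.trans (le_of_eq ?_))
  push_cast
  ring

end Ideal

/-! ### The dimension of the normal fiber cone -/

/-- By incomparability, contraction of primes along an integral map is strictly monotone. -/
theorem ringKrullDim_le_of_isIntegral {A B : Type*} [CommRing A] [CommRing B] (f : A →+* B)
    (hf : f.IsIntegral) : ringKrullDim B ≤ ringKrullDim A := by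
  algebraize [f]
  have : Algebra.IsIntegral A B := ⟨hf⟩
  refine Order.krullDim_le_of_strictMono (PrimeSpectrum.comap f) fun p q hpq => ?_
  have := p.isPrime
  exact Ideal.IsIntegral.comap_lt_comap (R := A) (show p.asIdeal < q.asIdeal from hpq)

theorem Nat.le_of_forall_pow_le_mul_pow {s d C : ℕ} (h : ∀ N : ℕ, 0 < N → N ^ s ≤ C * N ^ d) :
    s ≤ d := by
  by_contra! hsd
  have h1 := h (C + 1) (by omega)
  have h2 : (C + 1) ^ (d + 1) ≤ (C + 1) ^ s := Nat.pow_le_pow_right (by omega) hsd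
  rw [pow_succ'] at h2
  have h3 := Nat.le_of_mul_le_mul_right (h2.trans h1) (by positivity)
  omega

section FiberCone

variable {R : Type*} [CommRing R]

theorem Ideal.reesAlgebra_le_normalReesAlgebra (I : Ideal R) :
    reesAlgebra I ≤ I.normalReesAlgebra := fun _ hf n => le_intClosure _ (hf n)

theorem Ideal.isIntegral_inclusion_normalReesAlgebra (I : Ideal R) :
    (Subalgebra.inclusion I.reesAlgebra_le_normalReesAlgebra).toRingHom.IsIntegral := by
  intro f
  have h1 : IsIntegral (reesAlgebra I) (f : R[X]) := by
    rw [(f : R[X]).as_sum_support]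
    exact IsIntegral.sum _ fun n _ => (mem_intClosure_pow_iff I n _).mp (f.2 n)
  obtain ⟨q, hq, hqf⟩ := h1
  refine ⟨q, hq, Subtype.ext ?_⟩
  exact (Polynomial.hom_eval₂ q _ I.normalReesAlgebra.val.toRingHom f).trans hqf

theorem Ideal.length_quotient_pow_eq_sum (I : Ideal R) (n : ℕ) :
    Module.length R (R ⧸ I ^ n) = ∑ k ∈ Finset.range n,
      Module.length R (↥(I ^ k) ⧸ (I ^ (k + 1)).submoduleOf (I ^ k)) := by
  induction n with
  | zero =>
    have : Subsingleton (R ⧸ I ^ 0) := Submodule.Quotient.subsingleton_iff.mpr (by simp)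
    simp [Module.length_eq_zero]
  | succ n ih =>
    rw [Finset.sum_range_succ, ← ih]
    exact Module.length_quotient_eq_add (pow_le_pow_right (by omega))

variable [IsLocalRing R]

/-- Integrality of the normal Rees algebra over the Rees algebra descends to the closed fibers. -/
theorem ringKrullDim_normalFiberCone_le (I : Ideal R) :
    ringKrullDim (NormalFiberCone I) ≤ ringKrullDim (FiberCone I) := by
  let φ := (Subalgebra.inclusion I.reesAlgebra_le_normalReesAlgebra).toRingHom
  have hφ : (maximalIdeal R).map (algebraMap R (reesAlgebra I)) ≤
      ((maximalIdeal R).map (algebraMap R I.normalReesAlgebra)).comap φ := by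
    rw [Ideal.map_le_iff_le_comap]
    intro x hx
    exact Ideal.mem_map_of_mem (algebraMap R I.normalReesAlgebra) hx
  let ψ : FiberCone I →+* NormalFiberCone I := Ideal.quotientMap _ φ hφ
  refine ringKrullDim_le_of_isIntegral (A := FiberCone I) (B := NormalFiberCone I) ψ ?_
  have h1 : RingHom.IsIntegral (R := I.normalReesAlgebra) (A := NormalFiberCone I)
      (Ideal.Quotient.mk _) :=
    RingHom.isIntegral_of_surjective _ Ideal.Quotient.mk_surjective
  exact RingHom.IsIntegral.tower_top (R := reesAlgebra I) (S := FiberCone I)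
    (T := NormalFiberCone I) (Ideal.Quotient.mk _) ψ
    (RingHom.IsIntegral.trans (R := reesAlgebra I) (S := I.normalReesAlgebra)
      (T := NormalFiberCone I) _ _ I.isIntegral_inclusion_normalReesAlgebra h1)

instance nontrivial_fiberCone (I : Ideal R) : Nontrivial (FiberCone I) := by
  refine Ideal.Quotient.nontrivial_iff.mpr fun h => ?_
  have h1 : (1 : reesAlgebra I) ∈ (maximalIdeal R).map (algebraMap R (reesAlgebra I)) :=
    h ▸ Submodule.mem_top
  have h2 := (mem_map_maximalIdeal_iff (mem_reesAlgebra_iff I) _).mp h1 0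
  simp at h2

/-- The image in the fiber cone of the elements of the Rees algebra of degree at most `M`. -/
noncomputable def fiberConeDegreeLE (I : Ideal R) (M : ℕ) : Submodule R (FiberCone I) :=
  ((degreeLE R M).comap (reesAlgebra I).val.toLinearMap).map
    (Ideal.Quotient.mkₐ R ((maximalIdeal R).map (algebraMap R (reesAlgebra I)))).toLinearMap

theorem mem_fiberConeDegreeLE {I : Ideal R} {M : ℕ} {y : FiberCone I} :
    y ∈ fiberConeDegreeLE I M ↔
      ∃ f : reesAlgebra I, (f : R[X]).natDegree ≤ M ∧ Ideal.Quotient.mk _ f = y := by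
  simp only [fiberConeDegreeLE, Submodule.mem_map, Submodule.mem_comap, mem_degreeLE,
    ← natDegree_le_iff_degree_le]
  rfl

theorem fiberConeDegreeLE_mono (I : Ideal R) : Monotone (fiberConeDegreeLE I) := by
  intro M N h y hy
  rw [mem_fiberConeDegreeLE] at hy ⊢
  obtain ⟨f, hf, rfl⟩ := hy
  exact ⟨f, hf.trans h, rfl⟩

theorem one_mem_fiberConeDegreeLE (I : Ideal R) : (1 : FiberCone I) ∈ fiberConeDegreeLE I 0 :=
  mem_fiberConeDegreeLE.mpr ⟨1, by simp, map_one _⟩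

theorem mul_mem_fiberConeDegreeLE {I : Ideal R} {M N : ℕ} {x y : FiberCone I}
    (hx : x ∈ fiberConeDegreeLE I M) (hy : y ∈ fiberConeDegreeLE I N) :
    x * y ∈ fiberConeDegreeLE I (M + N) := by
  rw [mem_fiberConeDegreeLE] at hx hy ⊢
  obtain ⟨f, hf, rfl⟩ := hx
  obtain ⟨g, hg, rfl⟩ := hy
  exact ⟨f * g, natDegree_mul_le.trans (add_le_add hf hg), map_mul _ _ _⟩

theorem pow_mem_fiberConeDegreeLE {I : Ideal R} {M : ℕ} {x : FiberCone I}
    (hx : x ∈ fiberConeDegreeLE I M) (n : ℕ) : x ^ n ∈ fiberConeDegreeLE I (n * M) := by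
  induction n with
  | zero => simpa using one_mem_fiberConeDegreeLE I
  | succ n ih =>
    rw [pow_succ, Nat.succ_mul]
    exact mul_mem_fiberConeDegreeLE ih hx

theorem prod_mem_fiberConeDegreeLE {I : Ideal R} {ι : Type*} (s : Finset ι) {M : ι → ℕ}
    {x : ι → FiberCone I} (hx : ∀ i ∈ s, x i ∈ fiberConeDegreeLE I (M i)) :
    ∏ i ∈ s, x i ∈ fiberConeDegreeLE I (∑ i ∈ s, M i) := by
  classical
  induction s using Finset.induction_on with
  | empty => simpa using one_mem_fiberConeDegreeLE I
  | insert a s ha ih =>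
    rw [Finset.prod_insert ha, Finset.sum_insert ha]
    exact mul_mem_fiberConeDegreeLE (hx a (Finset.mem_insert_self a s))
      (ih fun i hi => hx i (Finset.mem_insert_of_mem hi))

theorem exists_mem_fiberConeDegreeLE {I : Ideal R} (y : FiberCone I) :
    ∃ M, y ∈ fiberConeDegreeLE I M := by
  obtain ⟨f, rfl⟩ := Ideal.Quotient.mk_surjective y
  exact ⟨(f : R[X]).natDegree, mem_fiberConeDegreeLE.mpr ⟨f, le_rfl, rfl⟩⟩

/-- As `I ^ (k + 1) ≤ 𝔪 * I ^ k`, the part of degree at most `M` is a quotient of the direct sum of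
the `I ^ k / I ^ (k + 1)` with `k ≤ M`. -/
theorem length_fiberConeDegreeLE_le {I : Ideal R} (hI : I ≤ maximalIdeal R) (M : ℕ) :
    Module.length R (fiberConeDegreeLE I M) ≤ Module.length R (R ⧸ I ^ (M + 1)) := by
  rw [I.length_quotient_pow_eq_sum, ← Fin.sum_univ_eq_sum_range (fun k =>
    Module.length R (↥(I ^ k) ⧸ (I ^ (k + 1)).submoduleOf (I ^ k))), ← Module.length_pi_of_fintype]
  let mon : (Π k : Fin (M + 1), ↥(I ^ (k : ℕ))) →ₗ[R] R[X] :=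
    ∑ k : Fin (M + 1), monomial (k : ℕ) ∘ₗ (I ^ (k : ℕ)).subtype ∘ₗ LinearMap.proj k
  have hcoeff : ∀ a (i : Fin (M + 1)), (mon a).coeff i = a i := fun a i => by
    simp only [mon, LinearMap.sum_apply, finsetSum_coeff, LinearMap.comp_apply, coeff_monomial]
    rw [Finset.sum_eq_single i]
    · simp
    · intro b _ hb
      rw [if_neg (by rwa [Fin.val_inj])]
    · simp
  have hcoeff' : ∀ a i, M < i → (mon a).coeff i = 0 := fun a i hi => by
    simp only [mon, LinearMap.sum_apply, finsetSum_coeff, LinearMap.comp_apply, coeff_monomial]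
    exact Finset.sum_eq_zero fun j _ => if_neg (by omega)
  have hmem : ∀ a, mon a ∈ Subalgebra.toSubmodule (reesAlgebra I) := fun a i => by
    by_cases hi : i < M + 1
    · have := hcoeff a ⟨i, hi⟩
      simp only at this
      rw [this]
      exact (a ⟨i, hi⟩).2
    · rw [hcoeff' a i (by omega)]
      exact zero_mem _
  let u : (Π k : Fin (M + 1), ↥(I ^ (k : ℕ))) →ₗ[R] reesAlgebra I := mon.codRestrict _ hmem
  let pr : reesAlgebra I →ₗ[R] FiberCone I :=
    (Ideal.Quotient.mkₐ R ((maximalIdeal R).map (algebraMap R (reesAlgebra I)))).toLinearMap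
  have hu : ∀ a, pr (u a) ∈ fiberConeDegreeLE I M := fun a =>
    mem_fiberConeDegreeLE.mpr ⟨u a, natDegree_le_iff_coeff_eq_zero.mpr (hcoeff' a), rfl⟩
  refine Module.length_le_of_ker_le (A := Π k : Fin (M + 1), ↥(I ^ (k : ℕ)))
    (LinearMap.pi fun k => Submodule.mkQ _ ∘ₗ LinearMap.proj k)
    ((pr ∘ₗ u).codRestrict (fiberConeDegreeLE I M) hu) ?_ ?_
  · rintro ⟨y, hy⟩
    obtain ⟨f, hf, rfl⟩ := mem_fiberConeDegreeLE.mp hy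
    refine ⟨fun k => ⟨(f : R[X]).coeff k, f.2 k⟩, Subtype.ext (congrArg pr (Subtype.ext ?_))⟩
    ext i
    change (mon _).coeff i = _
    by_cases hi : i < M + 1
    · exact hcoeff _ ⟨i, hi⟩
    · rw [hcoeff' _ i (by omega), coeff_eq_zero_of_natDegree_lt (by omega)]
  · intro a ha
    have ha' : ∀ k : Fin (M + 1), (a k : R) ∈ I ^ ((k : ℕ) + 1) := fun k => by
      have h1 : Submodule.mkQ ((I ^ ((k : ℕ) + 1)).submoduleOf (I ^ (k : ℕ))) (a k) = 0 :=
        congrFun ha k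
      rw [Submodule.mkQ_apply, Submodule.Quotient.mk_eq_zero] at h1
      exact h1
    refine Subtype.ext ?_
    change Ideal.Quotient.mk _ (u a) = 0
    rw [Ideal.Quotient.eq_zero_iff_mem, mem_map_maximalIdeal_iff (mem_reesAlgebra_iff I)]
    intro i
    change (mon a).coeff i ∈ _
    by_cases hi : i < M + 1
    · have := hcoeff a ⟨i, hi⟩
      simp only at this
      rw [this]
      have h2 := ha' ⟨i, hi⟩
      rw [pow_succ'] at h2
      exact Ideal.mul_mono_left hI h2
    · rw [hcoeff' a i (by omega)]
      exact zero_mem _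

variable [IsNoetherianRing R]

/-- Noether normalization gives a polynomial subring in `s` variables over which the fiber cone is
integral. The growth of the fiber cone, at most of order `d`, forces `s ≤ d`. -/
theorem ringKrullDim_fiberCone_le {I : Ideal R} (hI : I ≤ maximalIdeal R) {r : ℕ}
    (hr : maximalIdeal R ^ r ≤ I) : ringKrullDim (FiberCone I) ≤ ringKrullDim R := by
  let _ : Field (R ⧸ maximalIdeal R) := Ideal.Quotient.field _
  have : Algebra.FiniteType R (FiberCone I) :=
    Algebra.FiniteType.of_surjective
      (Ideal.Quotient.mkₐ R ((maximalIdeal R).map (algebraMap R (reesAlgebra I))))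
      Ideal.Quotient.mk_surjective
  have : Algebra.FiniteType (R ⧸ maximalIdeal R) (FiberCone I) :=
    Algebra.FiniteType.of_restrictScalars_finiteType R _ _
  obtain ⟨s, g, hg, hint⟩ := exists_integral_inj_algHom_of_fg (R ⧸ maximalIdeal R) (FiberCone I)
  refine (ringKrullDim_le_of_isIntegral g.toRingHom hint).trans ?_
  rw [MvPolynomial.ringKrullDim_of_isNoetherianRing, ringKrullDim_eq_zero_of_field, zero_add,
    Nat.card_eq_fintype_card, Fintype.card_fin, ← natCast_krullDimNat]
  obtain ⟨C, hC⟩ := Ideal.exists_length_quotient_pow_le hr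
  choose e he using fun i : Fin s => exists_mem_fiberConeDegreeLE (g (MvPolynomial.X i))
  let E := ∑ i, e i
  -- The `N ^ s` monomials with all exponents below `N` are linearly independent and lie in degree
  -- at most `N * E`, so `N ^ s ≤ ℓ(R / I ^ (N * E + 1)) ≤ C * (N * E + 1) ^ d`.
  have key : ∀ N : ℕ, 0 < N →
      N ^ s ≤ (C * (E + 1) ^ krullDimNat R) * N ^ krullDimNat R := fun N hN => by
    let v : (Fin s → Fin N) → FiberCone I := fun α => ∏ i, g (MvPolynomial.X i) ^ (α i : ℕ)
    have hv : ∀ α, v α ∈ fiberConeDegreeLE I (N * E) := fun α => by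
      refine fiberConeDegreeLE_mono I ?_
        (prod_mem_fiberConeDegreeLE _ fun i _ => pow_mem_fiberConeDegreeLE (he i) (α i))
      rw [Finset.mul_sum]
      exact Finset.sum_le_sum fun i _ => Nat.mul_le_mul_right _ (α i).2.le
    have hli : LinearIndependent (R ⧸ maximalIdeal R) v := by
      have h1 := (MvPolynomial.basisMonomials (Fin s) (R ⧸ maximalIdeal R)).linearIndependent
      have h2 := h1.map' g.toLinearMap (LinearMap.ker_eq_bot.mpr hg)
      let em : (Fin s → Fin N) → (Fin s →₀ ℕ) := fun α =>
        Finsupp.equivFunOnFinite.symm fun i => (α i : ℕ)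
      have hem : Function.Injective em := fun α β h => by
        funext i
        exact Fin.ext (DFunLike.congr_fun h i)
      have h3 := h2.comp em hem
      have hvem : v = (g.toLinearMap ∘
          MvPolynomial.basisMonomials (Fin s) (R ⧸ maximalIdeal R)) ∘ em := ?_
      · rw [hvem]
        exact h3
      funext α
      simp only [v, Function.comp_apply, MvPolynomial.coe_basisMonomials]
      change _ = g (MvPolynomial.monomial (em α) 1)
      rw [MvPolynomial.monomial_eq, map_one, one_mul, Finsupp.prod_fintype _ _ (by simp), map_prod]
      simp [em]
    let Λ : ((Fin s → Fin N) → R ⧸ maximalIdeal R) →ₗ[R] FiberCone I :=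
      (Fintype.linearCombination (R ⧸ maximalIdeal R) v).restrictScalars R
    have hΛ : Function.Injective Λ := hli.fintypeLinearCombination_injective
    have hΛ' : ∀ c, Λ c ∈ fiberConeDegreeLE I (N * E) := fun c => by
      change Fintype.linearCombination (R ⧸ maximalIdeal R) v c ∈ _
      rw [Fintype.linearCombination_apply]
      refine Submodule.sum_mem _ fun α _ => ?_
      obtain ⟨x, hx⟩ := Ideal.Quotient.mk_surjective (c α)
      rw [← hx, ← Ideal.Quotient.algebraMap_eq, algebraMap_smul]
      exact Submodule.smul_mem _ _ (hv α)
    have h1 := Module.length_le_of_injective (Λ.codRestrict _ hΛ')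
      (fun a b hab => hΛ (congrArg Subtype.val hab))
    have : IsSimpleModule R (R ⧸ maximalIdeal R) :=
      isSimpleModule_iff_quot_maximal.mpr ⟨maximalIdeal R, inferInstance, ⟨.refl _ _⟩⟩
    rw [Module.length_pi, Module.length_eq_one, mul_one, ENat.card_eq_coe_fintype_card] at h1
    have h2 := (h1.trans (length_fiberConeDegreeLE_le hI _)).trans (hC _)
    rw [Nat.cast_le] at h2
    simp only [Fintype.card_pi, Fintype.card_fin, Finset.prod_const, Finset.card_univ] at h2
    refine h2.trans ?_
    rw [mul_assoc, ← mul_pow]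
    gcongr
    nlinarith
  exact_mod_cast Nat.le_of_forall_pow_le_mul_pow key

theorem krullDimNat_normalFiberCone_le {I : Ideal R} (hI : I ≤ maximalIdeal R) {r : ℕ}
    (hr : maximalIdeal R ^ r ≤ I) : krullDimNat (NormalFiberCone I) ≤ krullDimNat R := by
  have h := (ringKrullDim_normalFiberCone_le I).trans (ringKrullDim_fiberCone_le hI hr)
  rw [← natCast_krullDimNat (R := R)] at h
  unfold krullDimNat at h ⊢
  generalize ringKrullDim (NormalFiberCone I) = a at *
  induction a using WithBot.recBotCoe with
  | bot => simp
  | coe a =>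
    have h' : a ≤ ((((ringKrullDim R).unbotD 0).toNat : ℕ) : ℕ∞) := by exact_mod_cast h
    exact ENat.toNat_le_of_le_natCast h'

end FiberCone

/-! ### Normalized upper limits -/

namespace ENNReal

theorem tendsto_natCast_pow_atTop {m : ℕ} (hm : m ≠ 0) :
    Tendsto (fun n : ℕ => (n : ℝ≥0∞) ^ m) atTop (nhds ⊤) := by
  have := (ENNReal.continuous_pow m).tendsto ⊤
  rw [ENNReal.top_pow hm] at this
  exact this.comp ENNReal.tendsto_nat_nhds_top

theorem mul_sum_range_pow_le (e n : ℕ) :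
    ((e + 1 : ℕ) : ℝ≥0∞) * ∑ k ∈ Finset.range n, ((k + 1 : ℕ) : ℝ≥0∞) ^ e ≤
      ((n + 1 : ℕ) : ℝ≥0∞) ^ (e + 1) := by
  have h : (e + 1) * ∑ k ∈ Finset.range n, (k + 1) ^ e ≤ (n + 1) ^ (e + 1) := by
    induction n with
    | zero => simp
    | succ n ih =>
      rw [Finset.sum_range_succ, mul_add]
      -- Bernoulli's inequality makes the sum telescope.
      have h1 : (n + 1) ^ (e + 1) + (e + 1) * (n + 1) ^ e ≤ (n + 1 + 1) ^ (e + 1) := by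
        have := pow_add_mul_le_add_pow_of_sq_nonneg (a := n + 1) (b := 1) (by positivity)
          (by positivity) (by positivity) (by positivity) (e + 1)
        simpa using this
      omega
  exact_mod_cast h

/-- If the increments of `h` are bounded by `r * μ`, the normalized limsup of `h` is bounded by
`r` times the normalized limsup of `μ`. -/
theorem limsup_factorial_mul_div_pow_le_of_le_sum (e : ℕ) (r : ℕ) (h μ : ℕ → ℝ≥0∞)
    (hμ : ∀ n, μ n ≠ ⊤) (hle : ∀ n, h n ≤ r * ∑ k ∈ Finset.range n, μ (k + 1)) :
    limsup (fun n : ℕ => ((e + 1).factorial : ℝ≥0∞) * h n / (n : ℝ≥0∞) ^ (e + 1)) atTop ≤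
      limsup (fun n : ℕ => (e.factorial : ℝ≥0∞) * μ n / (n : ℝ≥0∞) ^ e) atTop * r := by
  -- In `ℝ≥0∞` one has `⊤ * 0 = 0`, so `r = 0` must be separated from the case of an infinite upper
  -- limit.
  rcases Nat.eq_zero_or_pos r with rfl | hr
  · have : ∀ n, h n = 0 := fun n => by simpa using hle n
    simp [this]
  set c := limsup (fun n : ℕ => (e.factorial : ℝ≥0∞) * μ n / (n : ℝ≥0∞) ^ e) atTop with hc
  by_cases hctop : c = ⊤
  · rw [hctop, ENNReal.top_mul (by simpa using hr.ne')]
    exact le_top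
  have hr0 : (r : ℝ≥0∞) ≠ 0 := by simpa using hr.ne'
  rw [← ENNReal.div_le_iff hr0 (ENNReal.natCast_ne_top r)]
  refine le_of_forall_gt_imp_ge_of_dense fun b hb => ?_
  rw [ENNReal.div_le_iff hr0 (ENNReal.natCast_ne_top r)]
  rcases eq_or_ne b ⊤ with rfl | hbtop
  · rw [ENNReal.top_mul hr0]
    exact le_top
  have hev := eventually_lt_of_limsup_lt hb
  obtain ⟨k₀, hk₀⟩ := eventually_atTop.mp hev
  -- `C` collects the finitely many terms before the bound by `b` takes hold; it disappears after
  -- division by `n ^ (e + 1)`.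
  set C : ℝ≥0∞ := ∑ k ∈ Finset.range k₀, (e.factorial : ℝ≥0∞) * μ (k + 1) with hC
  have hCtop : C ≠ ⊤ :=
    ENNReal.sum_ne_top.mpr fun k _ => ENNReal.mul_ne_top (ENNReal.natCast_ne_top _) (hμ _)
  have hterm : ∀ k, k₀ ≤ k → (e.factorial : ℝ≥0∞) * μ (k + 1) ≤ b * ((k + 1 : ℕ) : ℝ≥0∞) ^ e :=
    fun k hk => by
      have := (hk₀ (k + 1) (by omega)).le
      rwa [ENNReal.div_le_iff (by positivity) (by finiteness)] at this
  have hsum : ∀ n, (e.factorial : ℝ≥0∞) * ∑ k ∈ Finset.range n, μ (k + 1) ≤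
      C + b * ∑ k ∈ Finset.range n, ((k + 1 : ℕ) : ℝ≥0∞) ^ e := fun n => by
    induction n with
    | zero => simp
    | succ n ih =>
      by_cases hn : n < k₀
      · refine le_add_right ?_
        rw [Finset.mul_sum]
        exact Finset.sum_le_sum_of_subset (Finset.range_mono hn)
      · rw [Finset.sum_range_succ, Finset.sum_range_succ, mul_add, mul_add, ← add_assoc]
        exact add_le_add ih (hterm n (by omega))
  have hbound : ∀ n : ℕ, n ≠ 0 →
      ((e + 1).factorial : ℝ≥0∞) * h n / (n : ℝ≥0∞) ^ (e + 1) ≤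
        r * (((e + 1 : ℕ) : ℝ≥0∞) * C / (n : ℝ≥0∞) ^ (e + 1) +
          b * (1 + (n : ℝ≥0∞)⁻¹) ^ (e + 1)) := fun n hn => by
    have hn0 : (n : ℝ≥0∞) ^ (e + 1) ≠ 0 := by positivity
    have hnt : (n : ℝ≥0∞) ^ (e + 1) ≠ ⊤ := by finiteness
    rw [ENNReal.div_le_iff hn0 hnt]
    have h1 : (1 + (n : ℝ≥0∞)⁻¹) ^ (e + 1) * (n : ℝ≥0∞) ^ (e + 1) =
        ((n + 1 : ℕ) : ℝ≥0∞) ^ (e + 1) := by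
      rw [← mul_pow, add_mul, one_mul, ENNReal.inv_mul_cancel (by simpa using hn) (by finiteness)]
      push_cast; rfl
    calc ((e + 1).factorial : ℝ≥0∞) * h n
        ≤ ((e + 1).factorial : ℝ≥0∞) * (r * ∑ k ∈ Finset.range n, μ (k + 1)) := by
          gcongr; exact hle n
      _ = r * (((e + 1 : ℕ) : ℝ≥0∞) *
            ((e.factorial : ℝ≥0∞) * ∑ k ∈ Finset.range n, μ (k + 1))) := by
          rw [Nat.factorial_succ]; push_cast; ring
      _ ≤ r * (((e + 1 : ℕ) : ℝ≥0∞) *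
            (C + b * ∑ k ∈ Finset.range n, ((k + 1 : ℕ) : ℝ≥0∞) ^ e)) := by
          gcongr; exact hsum n
      _ = r * (((e + 1 : ℕ) : ℝ≥0∞) * C + b * (((e + 1 : ℕ) : ℝ≥0∞) *
            ∑ k ∈ Finset.range n, ((k + 1 : ℕ) : ℝ≥0∞) ^ e)) := by ring
      _ ≤ r * (((e + 1 : ℕ) : ℝ≥0∞) * C + b * ((n + 1 : ℕ) : ℝ≥0∞) ^ (e + 1)) := by
          gcongr; exact mul_sum_range_pow_le e n
      _ = _ := by
          rw [mul_assoc (r : ℝ≥0∞), add_mul, ENNReal.div_mul_cancel hn0 hnt, mul_assoc b, h1]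
  have hlim : Tendsto (fun n : ℕ => (r : ℝ≥0∞) * (((e + 1 : ℕ) : ℝ≥0∞) * C /
      (n : ℝ≥0∞) ^ (e + 1) + b * (1 + (n : ℝ≥0∞)⁻¹) ^ (e + 1))) atTop
      (nhds (r * (0 + b * (1 + 0) ^ (e + 1)))) := by
    refine ENNReal.Tendsto.const_mul (Tendsto.add ?_ (ENNReal.Tendsto.const_mul ?_ ?_)) ?_
    · have := ENNReal.Tendsto.const_div (a := ((e + 1 : ℕ) : ℝ≥0∞) * C)
        (tendsto_natCast_pow_atTop (Nat.succ_ne_zero e)) (Or.inr (by finiteness))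
      rwa [ENNReal.div_top] at this
    · exact ENNReal.Tendsto.pow (tendsto_const_nhds.add ENNReal.tendsto_inv_nat_nhds_zero)
    · exact Or.inr hbtop
    · exact Or.inr (ENNReal.natCast_ne_top r)
  rw [zero_add, add_zero, one_pow, mul_one, mul_comm (r : ℝ≥0∞) b] at hlim
  rw [← hlim.limsup_eq]
  exact limsup_le_limsup ((eventually_ne_atTop 0).mono hbound)

/-- If `a < e` and the right side is finite, then `μ n = O(n ^ a)` and the left side is zero. This
covers a normal fiber cone of dimension less than `d`. -/
theorem limsup_factorial_mul_div_pow_antitone {a e : ℕ} (hae : a ≤ e) (μ : ℕ → ℝ≥0∞) :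
    limsup (fun n : ℕ => (e.factorial : ℝ≥0∞) * μ n / (n : ℝ≥0∞) ^ e) atTop ≤
      limsup (fun n : ℕ => (a.factorial : ℝ≥0∞) * μ n / (n : ℝ≥0∞) ^ a) atTop := by
  rcases hae.eq_or_lt with rfl | hlt
  · exact le_rfl
  set c := limsup (fun n : ℕ => (a.factorial : ℝ≥0∞) * μ n / (n : ℝ≥0∞) ^ a) atTop with hc
  by_cases hctop : c = ⊤
  · rw [hctop]; exact le_top
  obtain ⟨b, hcb, hb⟩ := exists_between (lt_top_iff_ne_top.mpr hctop)
  have hev := eventually_lt_of_limsup_lt hcb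
  have hlim : Tendsto (fun n : ℕ => (e.factorial : ℝ≥0∞) * b / (n : ℝ≥0∞) ^ (e - a)) atTop
      (nhds 0) := by
    have := ENNReal.Tendsto.const_div (a := (e.factorial : ℝ≥0∞) * b)
      (tendsto_natCast_pow_atTop (Nat.sub_ne_zero_of_lt hlt))
      (Or.inr (ENNReal.mul_ne_top (ENNReal.natCast_ne_top _) hb.ne))
    rwa [ENNReal.div_top] at this
  refine le_trans ?_ (zero_le (a := c))
  rw [← hlim.limsup_eq]
  refine limsup_le_limsup ?_
  filter_upwards [hev, eventually_ne_atTop 0] with n hn hn0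
  have hna : (n : ℝ≥0∞) ^ a ≠ 0 := by positivity
  have hnat : (n : ℝ≥0∞) ^ a ≠ ⊤ := by finiteness
  have hne : (n : ℝ≥0∞) ^ e ≠ 0 := by positivity
  have hnet : (n : ℝ≥0∞) ^ e ≠ ⊤ := by finiteness
  have h1 : μ n ≤ b * (n : ℝ≥0∞) ^ a := by
    rw [ENNReal.div_lt_iff (Or.inl hna) (Or.inl hnat)] at hn
    refine le_trans ?_ hn.le
    refine le_mul_of_one_le_left (zero_le) ?_
    exact_mod_cast Nat.factorial_pos a
  rw [ENNReal.div_le_iff hne hnet]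
  calc (e.factorial : ℝ≥0∞) * μ n ≤ e.factorial * (b * (n : ℝ≥0∞) ^ a) := by gcongr
    _ = e.factorial * b / (n : ℝ≥0∞) ^ (e - a) * ((n : ℝ≥0∞) ^ (e - a)) * (n : ℝ≥0∞) ^ a := by
      rw [ENNReal.div_mul_cancel (by positivity) (by finiteness), mul_assoc]
    _ = _ := by rw [mul_assoc, ← pow_add, Nat.sub_add_cancel hae]

end ENNReal

/-! ### The multiplicity inequalities -/

theorem ENat.toENNReal_finsetSum {ι : Type*} (s : Finset ι) (f : ι → ℕ∞) :
    ((∑ i ∈ s, f i : ℕ∞) : ℝ≥0∞) = ∑ i ∈ s, (f i : ℝ≥0∞) :=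
  map_sum ENat.toENNRealRingHom f s

theorem Ideal.IsNormal.reesAlgebra_eq {R : Type*} [CommRing R] {I : Ideal R} (hI : I.IsNormal) :
    reesAlgebra I = I.normalReesAlgebra := by
  ext f
  exact forall_congr' fun n => by rw [hI n]

theorem normalMultiplicity_le {R : Type*} [CommRing R] [IsLocalRing R] [IsNoetherianRing R]
    (hdim : 0 < ringKrullDim R) {I : Ideal R} (hI : I ≤ maximalIdeal R) {r : ℕ}
    (hr : maximalIdeal R ^ r ≤ I) :
    normalMultiplicity I ≤ normalFiberConeMultiplicity I * (r : ℝ≥0∞) := by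
  have hd : 0 < krullDimNat R := by
    rw [← natCast_krullDimNat] at hdim
    exact_mod_cast hdim
  have hδ := krullDimNat_normalFiberCone_le hI hr
  unfold normalMultiplicity familyMultiplicity normalFiberConeMultiplicity gradedMultiplicity
  obtain ⟨e, he⟩ := Nat.exists_eq_succ_of_ne_zero hd.ne'
  rw [he]
  generalize krullDimNat (NormalFiberCone I) = δ at *
  have hS : ∀ f, f ∈ I.normalReesAlgebra ↔ ∀ n, f.coeff n ∈ (I ^ n).intClosure := fun _ => Iff.rfl
  have hlen : ∀ n, Module.length R (ClosedFiber.degreePart I.normalReesAlgebra n) =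
      Module.length R ((I ^ n).intClosure ⧸
        (maximalIdeal R • ⊤ : Submodule R (I ^ n).intClosure)) := fun n => by
    obtain ⟨eq⟩ := ClosedFiber.nonempty_degreePart_equiv hS n
    exact eq.length_eq.symm
  simp_rw [hlen]
  have hμ : ∀ n, Module.length R ((I ^ n).intClosure ⧸
      (maximalIdeal R • ⊤ : Submodule R (I ^ n).intClosure)) ≠ ⊤ := fun n htop => by
    have h1 := Ideal.length_quotient_mul_maximalIdeal (I ^ n).intClosure
    rw [htop, add_top] at h1
    refine Ideal.length_quotient_ne_top_of_pow_le (N := r * n + 1) ?_ h1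
    rw [pow_succ', pow_mul]
    exact Ideal.mul_mono_right ((Ideal.pow_right_mono hr n).trans (Ideal.le_intClosure _))
  refine (ENNReal.limsup_factorial_mul_div_pow_le_of_le_sum e r _
    (fun n => (Module.length R ((I ^ n).intClosure ⧸
      (maximalIdeal R • ⊤ : Submodule R (I ^ n).intClosure)) : ℝ≥0∞))
    (fun n => by simpa using hμ n) fun n => ?_).trans ?_
  · have h1 := Ideal.length_quotient_intClosure_pow_le_sum hdim hr n
    rw [← ENat.toENNReal_le, ENat.toENNReal_mul, ENat.toENNReal_finsetSum] at h1
    simpa using h1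
  · gcongr
    exact ENNReal.limsup_factorial_mul_div_pow_antitone (by omega) _

theorem Ideal.IsNormal.fiberConeMultiplicity_eq {R : Type*} [CommRing R] [IsLocalRing R]
    {I : Ideal R} (hI : I.IsNormal) :
    fiberConeMultiplicity I = normalFiberConeMultiplicity I := by
  unfold fiberConeMultiplicity normalFiberConeMultiplicity FiberCone NormalFiberCone
  rw [hI.reesAlgebra_eq]

theorem Ideal.IsNormal.samuelMultiplicity_eq {R : Type*} [CommRing R] {I : Ideal R}
    (hI : I.IsNormal) : samuelMultiplicity I = normalMultiplicity I := by
  unfold samuelMultiplicity normalMultiplicity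
  simp_rw [hI _]

/-- Some power of the radical lies in `I`, so the infimum defining `loewyLength` is attained and is
not the default value of `sInf ∅`. -/
theorem pow_loewyLength_le {R : Type*} [CommRing R] [IsLocalRing R] [IsNoetherianRing R]
    {I : Ideal R} (hI : I.radical = maximalIdeal R) : maximalIdeal R ^ loewyLength I ≤ I := by
  obtain ⟨n, hn⟩ := Ideal.exists_radical_pow_le_of_fg I (IsNoetherian.noetherian _)
  rw [hI] at hn
  exact Nat.sInf_mem (s := {n : ℕ | maximalIdeal R ^ n ≤ I}) ⟨n, hn⟩

theorem mainTheorem8 {R : Type*} [CommRing R] [IsLocalRing R] [IsNoetherianRing R]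
    (hdim : 0 < ringKrullDim R) (I : Ideal R) (hI : I.radical = maximalIdeal R) :
    normalMultiplicity I ≤ normalFiberConeMultiplicity I * (loewyLength I : ℝ≥0∞) ∧
      (I.IsNormal →
        samuelMultiplicity I ≤ fiberConeMultiplicity I * (loewyLength I : ℝ≥0∞)) := by
  have h := normalMultiplicity_le hdim (Ideal.le_radical.trans hI.le) (pow_loewyLength_le hI)
  exact ⟨h, fun hn => by rwa [hn.samuelMultiplicity_eq, hn.fiberConeMultiplicity_eq]⟩
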